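/- Consider $N\ge 1$ parallel exponential servers with service rates $\mu_1,\dots,\mu_N>0$, fed by a Poisson stream of jobs of rate $\lambda>0$, and suppose the system is stabilizable, i.e. $\lambda<\sum_{n=1}^N\mu_n$. Let $x\in\mathbb{Z}_{\ge0}^N$ be the vector of queue lengths. For a weight vector $w\in\mathbb{R}^N_{>0}$ and a temperature $\iota>0$, the softmax WSQ (weighted shortest queue) policy sends an arriving job to server $a$ with probability $$\pi_w(a\mid x)=\frac{e^{-w_a(2x_a+1)/\iota}}{\sum_{b=1}^N e^{-w_b(2x_b+1)/\iota}} .$$ Then, for every $\iota>0$ and every $w\in\mathbb{R}^N_{>0}$, the discrete-time queue-length Markov chain induced by $\pi_w$ is ergodic and positive Harris recurrent. Precisely: 1. Let $x[k]$ be the queue lengths at the epochs of the merged Poisson clock of rate $\Lambda=\lambda+\sum_n\mu_n$: from $x$ the chain moves to $x+e_a$ with probability $\pi_w(a\mid x)\lambda/\Lambda$, and with probability $\mu_n/\Lambda$ a potential service completion occurs at server $n$, which replaces $x_n$ by $\max(x_n-1,0)$. This chain is positive Harris recurrent, and it is ergodic: all states communicate, it is aperiodic, and there is an invariant probability $d_w$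 such that, for every initial state, the law of $x[k]$ converges to $d_w$ in total variation as $k\to\infty$. 2. Let $x[k]$ be the queue lengths at the jump epochs only (arrivals and actual departures): from $x$ the chain moves to $x+e_a$ with probability $\pi_w(a\mid x)\lambda/\Lambda(x)$ and to $x-e_n$ with probability $\mu_n\mathbb{I}_{\{x_n\ge1\}}/\Lambda(x)$, where $\Lambda(x)=\lambda+\sum_n\mu_n\mathbb{I}_{\{x_n\ge1\}}$. This chain is positive Harris recurrent, and it is ergodic in the sense appropriate to its period: all states communicate, every state has period $2$, and there is an invariant probability $d_w$ such that, for every initial state, the average of the laws of $x[k]$ and $x[k+1]$ converges to $d_w$ in total variation as $k\to\infty$. Here a chain with transition kernel $P$ is called positive Harris recurrent if it is $\varphi$-irreducible for some nonzero $\sigma$-finite measure $\varphi$, every measurable set that has positive measure under some $\sigma$-finite irreducibility measure is visited infinitely often with probability one from every initial state, and $P$ has an invariant probability measure. -/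

import Mathlib

open MeasureTheory ProbabilityTheory Filter Finset

noncomputable section

/-! ### Time-homogeneous Markov chains in discrete time -/

namespace MarkovChain

variable {S : Type*} [MeasurableSpace S]

/-- Law on path space `ℕ → S` of the Markov chain with transition kernel `κ` started at `x`
(Ionescu-Tulcea construction). -/
def pathLaw (κ : Kernel S S) [IsMarkovKernel κ] (x : S) : Measure (ℕ → S) :=
  Kernel.traj (X := fun _ => S)
    (fun n => κ.comap (fun h : (i : Iic n) → S => h ⟨n, mem_Iic.2 le_rfl⟩)
      (measurable_pi_apply _)) 0 (fun _ => x)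

/-- Total variation distance `sup_A |μ(A) - ν(A)|` (meant for finite measures). -/
def tvDist (μ ν : Measure S) : ℝ :=
  ⨆ A : {A : Set S // MeasurableSet A}, |μ.real A.1 - ν.real A.1|

/-- Positive Harris recurrence: the chain is `φ`-irreducible for some nontrivial `φ`; every set
charged by some irreducibility measure (equivalently, by the maximal one) is visited infinitely
often with probability one from every initial state; and there is an invariant probability. -/
structure IsPositiveHarris (κ : Kernel S S) [IsMarkovKernel κ] : Prop where
  irreducible : ∃ φ : Measure S, SigmaFinite φ ∧ φ ≠ 0 ∧ Kernel.IsIrreducible φ κ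
  recurrent : ∀ φ : Measure S, SigmaFinite φ → Kernel.IsIrreducible φ κ →
    ∀ A : Set S, MeasurableSet A → 0 < φ A →
      ∀ x : S, ∀ᵐ ω ∂(pathLaw κ x), ∃ᶠ n in atTop, ω n ∈ A
  positive : ∃ π : Measure S, IsProbabilityMeasure π ∧ Kernel.Invariant κ π

/-- Every state has period `d`: the common divisors of its possible return times are exactly the
divisors of `d`, i.e. `d` is their greatest common divisor. -/
def HasPeriod (κ : Kernel S S) (d : ℕ) : Prop :=
  ∀ x : S, ∀ m : ℕ, (∀ n : ℕ, 1 ≤ n → 0 < (κ ^ n) x {x} → m ∣ n) ↔ m ∣ d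

/-- The average `d⁻¹ ∑_{r < d} κ^{n+r}(x, ·)` of the laws at `d` consecutive times. -/
def averagedLaw (κ : Kernel S S) (d n : ℕ) (x : S) : Measure S :=
  (d : ENNReal)⁻¹ • ∑ r ∈ range d, (κ ^ (n + r)) x

/-- Ergodicity of a chain of period `d` on a countable state space: all states communicate, all
have period `d`, and there is an invariant probability `π` to which the law of the chain,
averaged over one period, converges in total variation from every initial state.
For `d = 1` this is the usual ergodicity: `κ^n(x, ·) → π` in total variation. -/
structure IsErgodicOfPeriod (κ : Kernel S S) (d : ℕ) : Prop where
  communicates : ∀ x y : S, ∃ n : ℕ, 0 < (κ ^ n) x {y}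
  period : HasPeriod κ d
  converges : ∃ π : Measure S, IsProbabilityMeasure π ∧ Kernel.Invariant κ π ∧
    ∀ x : S, Tendsto (fun n => tvDist (averagedLaw κ d n x) π) atTop (nhds 0)

/-- Ergodicity in the usual (aperiodic) sense. -/
def IsErgodic (κ : Kernel S S) : Prop := IsErgodicOfPeriod κ 1

end MarkovChain

/-! ### Parallel queues under the softmax weighted-shortest-queue policy -/

/-- `N` parallel exponential servers fed by one Poisson stream of jobs. -/
structure ParallelSystem (N : ℕ) where
  /-- arrival rate -/
  lam : ℝ
  /-- service rates -/
  mu : Fin N → ℝ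
  lam_pos : 0 < lam
  mu_pos : ∀ n, 0 < mu n

namespace ParallelSystem

variable {N : ℕ}

/-- The system is stabilizable: the arrival rate is below the total service rate. -/
def Stabilizable (Q : ParallelSystem N) : Prop := Q.lam < ∑ n, Q.mu n

/-- Softmax WSQ policy `π_w(a|x)` with temperature `ι`. The index `w_a (2 x_a + 1)` is the increase
of `∑ n, w_n x_n²` when a job joins queue `a`. -/
def softmaxWSQ (ι : ℝ) (w : Fin N → ℝ) (x : Fin N → ℕ) (a : Fin N) : ℝ :=
  Real.exp (-(w a * (2 * (x a : ℝ) + 1)) / ι) /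
    ∑ b, Real.exp (-(w b * (2 * (x b : ℝ) + 1)) / ι)

/-- Queue lengths after a job joins queue `a`. -/
def arrive (x : Fin N → ℕ) (a : Fin N) : Fin N → ℕ := Function.update x a (x a + 1)

/-- Queue lengths after a service completion at server `n` (no change if queue `n` is empty). -/
def depart (x : Fin N → ℕ) (n : Fin N) : Fin N → ℕ := Function.update x n (x n - 1)

/-- Transition law `p(·|a,x)` over the epochs of the merged Poisson clock of rate `λ + ∑ μ_n`
(arrivals and, at every server, potential service completions; a potential service completion at
an empty queue leaves the state unchanged). -/
def eventStep (Q : ParallelSystem N) (a : Fin N) (x : Fin N → ℕ) : Measure (Fin N → ℕ) :=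
  ENNReal.ofReal (Q.lam / (Q.lam + ∑ k, Q.mu k)) • Measure.dirac (arrive x a) +
    ∑ n, ENNReal.ofReal (Q.mu n / (Q.lam + ∑ k, Q.mu k)) • Measure.dirac (depart x n)

/-- Service rate of server `n` in state `x`: `μ_n` if queue `n` is nonempty, else `0`. -/
def activeRate (Q : ParallelSystem N) (x : Fin N → ℕ) (n : Fin N) : ℝ :=
  if 1 ≤ x n then Q.mu n else 0

/-- Transition law `p(·|a,x)` over the jump epochs of the continuous-time queue-length process
(arrivals and actual departures only). -/
def jumpStep (Q : ParallelSystem N) (a : Fin N) (x : Fin N → ℕ) : Measure (Fin N → ℕ) :=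
  ENNReal.ofReal (Q.lam / (Q.lam + ∑ k, Q.activeRate x k)) • Measure.dirac (arrive x a) +
    ∑ n, ENNReal.ofReal (Q.activeRate x n / (Q.lam + ∑ k, Q.activeRate x k)) •
      Measure.dirac (depart x n)

/-- Transition kernel of the queue-length chain observed at the epochs of the merged Poisson
clock, under the softmax WSQ policy: `∑ a, π_w(a|x) p(·|a,x)`. -/
def eventChain (Q : ParallelSystem N) (ι : ℝ) (w : Fin N → ℝ) :
    Kernel (Fin N → ℕ) (Fin N → ℕ) where
  toFun x := ∑ a, ENNReal.ofReal (softmaxWSQ ι w x a) • Q.eventStep a x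
  measurable' := Measurable.of_discrete

/-- Transition kernel of the queue-length chain observed at its jump epochs, under the softmax WSQ
policy: `∑ a, π_w(a|x) p(·|a,x)`. -/
def jumpChain (Q : ParallelSystem N) (ι : ℝ) (w : Fin N → ℝ) :
    Kernel (Fin N → ℕ) (Fin N → ℕ) where
  toFun x := ∑ a, ENNReal.ofReal (softmaxWSQ ι w x a) • Q.jumpStep a x
  measurable' := Measurable.of_discrete

lemma softmaxWSQ_nonneg (ι : ℝ) (w : Fin N → ℝ) (x : Fin N → ℕ) (a : Fin N) :
    0 ≤ softmaxWSQ ι w x a := by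
  unfold softmaxWSQ; positivity

lemma sum_softmaxWSQ [NeZero N] (ι : ℝ) (w : Fin N → ℝ) (x : Fin N → ℕ) :
    ∑ a, softmaxWSQ ι w x a = 1 := by
  unfold softmaxWSQ
  rw [← Finset.sum_div]
  exact div_self (Finset.sum_pos (fun _ _ => Real.exp_pos _) Finset.univ_nonempty).ne'

lemma mass_eq_one {r : ℝ} {v : Fin N → ℝ} (hr : 0 < r) (hv : ∀ n, 0 ≤ v n)
    (y : Fin N → ℕ) (z : Fin N → Fin N → ℕ) :
    (ENNReal.ofReal (r / (r + ∑ k, v k)) • Measure.dirac y +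
      ∑ n, ENNReal.ofReal (v n / (r + ∑ k, v k)) • Measure.dirac (z n)) Set.univ = 1 := by
  have hs : 0 ≤ ∑ k, v k := Finset.sum_nonneg fun n _ => hv n
  have ht : 0 < r + ∑ k, v k := by linarith
  simp only [Measure.add_apply, Measure.smul_apply, Measure.finsetSum_apply, measure_univ,
    smul_eq_mul, mul_one]
  rw [← ENNReal.ofReal_sum_of_nonneg (fun n _ => div_nonneg (hv n) ht.le),
    ← ENNReal.ofReal_add (div_nonneg hr.le ht.le)
      (Finset.sum_nonneg fun n _ => div_nonneg (hv n) ht.le),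
    ← Finset.sum_div, ← add_div, div_self ht.ne', ENNReal.ofReal_one]

lemma activeRate_nonneg (Q : ParallelSystem N) (x : Fin N → ℕ) (n : Fin N) :
    0 ≤ Q.activeRate x n := by
  unfold activeRate; split_ifs
  · exact (Q.mu_pos n).le
  · exact le_rfl

lemma mix_eq_one [NeZero N] (ι : ℝ) (w : Fin N → ℝ) (x : Fin N → ℕ)
    (p : Fin N → Measure (Fin N → ℕ)) (hp : ∀ a, p a Set.univ = 1) :
    (∑ a, ENNReal.ofReal (softmaxWSQ ι w x a) • p a) Set.univ = 1 := by
  simp only [Measure.finsetSum_apply, Measure.smul_apply, hp, smul_eq_mul, mul_one]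
  rw [← ENNReal.ofReal_sum_of_nonneg (fun n _ => softmaxWSQ_nonneg ι w x n), sum_softmaxWSQ,
    ENNReal.ofReal_one]

instance [NeZero N] (Q : ParallelSystem N) (ι : ℝ) (w : Fin N → ℝ) :
    IsMarkovKernel (Q.eventChain ι w) :=
  ⟨fun x => ⟨mix_eq_one ι w x _ fun _ => mass_eq_one Q.lam_pos (fun n => (Q.mu_pos n).le) _ _⟩⟩

instance [NeZero N] (Q : ParallelSystem N) (ι : ℝ) (w : Fin N → ℝ) :
    IsMarkovKernel (Q.jumpChain ι w) :=
  ⟨fun x => ⟨mix_eq_one ι w x _ fun _ => mass_eq_one Q.lam_pos (Q.activeRate_nonneg x) _ _⟩⟩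

end ParallelSystem

end

/-! Stability comes from Foster's criterion with V(x) = ∑ w_n x_n². A job joining queue a raises V
by `joinCost`, the index in the softmax exponent, so the policy nearly minimizes this increase: its
mean is within Nι of the smallest one (`sum_softmaxWSQ_mul_joinCost_le`). The smallest is at most
the average with weights μ_c / ∑ μ, while service lowers V at rate ∑ μ_n joinCost_n up to a
constant. Hence the drift is at most a constant minus (1 - λ/∑ μ) ∑ μ_n joinCost_n
(`generator_quadratic_le`), which is below any given level off a finite set. The service rate of an
empty queue plays no role, so `rateChain` treats both chains at once.

The drift forces the Cesàro averages of the laws to keep mass on a finite set, and a pointwise limit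
point of them normalizes to an invariant probability (`exists_invariant_of_drift`). All states
communicate through the empty state. The probability of avoiding a given state forever is
subharmonic and vanishes at that state, hence vanishes everywhere (`eq_zero_of_le_lintegral`); this
gives Harris recurrence.

For convergence, the ℓ¹ distance of the law to π never increases. The laws started at x are
dominated by π / π{x}, so a limit point h of the differences can be taken with dominated
convergence, and every power of the kernel preserves its ℓ¹ norm. If h had both signs within one
cyclic class, two states of opposite sign could reach a common state at the same time and mass would
cancel (`tsum_abs_push_lt`). As h has zero mass on each class, h = 0
(`eq_zero_of_tsum_abs_push_eq`). For the jump chain the classes are the parities of the number of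
jobs, and averaging over two consecutive times balances them. -/

open scoped ENNReal Topology

noncomputable section

namespace MarkovChain

variable {S : Type*} [MeasurableSpace S]

/-! ### Path space and the Markov property -/

section Paths

variable (κ : Kernel S S)

/-- Probability that the chain stays in `A` at the times `0, …, k`. -/
def stayProb (A : Set S) : ℕ → S → ℝ≥0∞
  | 0 => A.indicator 1
  | k + 1 => A.indicator fun x => ∫⁻ z, stayProb A k z ∂κ x

variable [IsMarkovKernel κ]

lemma stayProb_le_one (A : Set S) (k : ℕ) (x : S) : stayProb κ A k x ≤ 1 := by
  induction k generalizing x with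
  | zero => exact Set.indicator_le (fun _ _ => le_rfl) x
  | succ k ih =>
    refine (Set.indicator_le_self _ _ x).trans ?_
    calc ∫⁻ z, stayProb κ A k z ∂κ x ≤ ∫⁻ _, 1 ∂κ x := lintegral_mono ih
      _ = 1 := by simp

lemma stayProb_antitone (A : Set S) : Antitone (stayProb κ A) := by
  refine antitone_nat_of_succ_le fun k => ?_
  induction k with
  | zero =>
    refine fun x => Set.indicator_le_indicator ?_
    calc ∫⁻ z, stayProb κ A 0 z ∂κ x ≤ ∫⁻ _, 1 ∂κ x :=
          lintegral_mono (stayProb_le_one κ A 0)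
      _ = 1 := by simp
  | succ k ih => exact fun x => Set.indicator_le_indicator (lintegral_mono ih)

variable [Countable S] [DiscreteMeasurableSpace S]

instance (x : S) : IsProbabilityMeasure (pathLaw κ x) := by
  unfold pathLaw; infer_instance

/-- The Markov property at time `n`, tested on functions of the next state. -/
lemma lintegral_pathLaw_mul_succ (x : S) (n : ℕ) (F : (Iic n → S) → ℝ≥0∞) (u : S → ℝ≥0∞) :
    ∫⁻ ω, F (Preorder.frestrictLe n ω) * u (ω (n + 1)) ∂pathLaw κ x =
      ∫⁻ ω, F (Preorder.frestrictLe n ω) * ∫⁻ z, u z ∂κ (ω n) ∂pathLaw κ x := by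
  set K : (n : ℕ) → Kernel ((i : Iic n) → S) S :=
    fun n => κ.comap (fun h : (i : Iic n) → S => h ⟨n, mem_Iic.2 le_rfl⟩)
      (measurable_pi_apply _) with hK
  have hF : Measurable F := Measurable.of_discrete
  have hu : Measurable u := Measurable.of_discrete
  have hfr : Measurable (Preorder.frestrictLe (π := fun _ : ℕ => S) n) :=
    Preorder.measurable_frestrictLe n
  have hmeas : Measurable fun ω : ℕ → S =>
      F (Preorder.frestrictLe n ω) * u (ω (n + 1)) :=
    (hF.comp hfr).mul (hu.comp (measurable_pi_apply _))
  have hleft : pathLaw κ x = (Kernel.traj (X := fun _ => S) K n ∘ₖ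
      Kernel.partialTraj (X := fun _ => S) K 0 n) (fun _ => x) := by
    rw [Kernel.traj_comp_partialTraj (Nat.zero_le n)]; rfl
  have hmap : (pathLaw κ x).map (Preorder.frestrictLe n) =
      Kernel.partialTraj (X := fun _ => S) K 0 n (fun _ => x) :=
    Kernel.traj_map_frestrictLe_apply 0 n _
  have hright : ∫⁻ ω, F (Preorder.frestrictLe n ω) * ∫⁻ z, u z ∂κ (ω n) ∂pathLaw κ x =
      ∫⁻ y, F y * ∫⁻ z, u z ∂K n y
        ∂(Kernel.partialTraj (X := fun _ => S) K 0 n (fun _ => x)) := by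
    rw [← hmap, lintegral_map Measurable.of_discrete hfr]
    rfl
  rw [hright, hleft, Kernel.lintegral_comp _ _ _ hmeas]
  refine lintegral_congr fun y => ?_
  -- Conditioned on the history y up to time n, the trajectory almost surely extends y, so the
  -- factor F is constant and only the law of the next state remains.
  have hae : ∀ᵐ ω ∂(Kernel.traj (X := fun _ => S) K n y), Preorder.frestrictLe n ω = y := by
    have h : (Kernel.traj (X := fun _ => S) K n y).map (Preorder.frestrictLe n) =
        Measure.dirac y := by
      rw [Kernel.traj_map_frestrictLe_apply, Kernel.partialTraj_self, Kernel.id_apply]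
    refine ae_of_ae_map (f := Preorder.frestrictLe (π := fun _ : ℕ => S) n) (p := fun z => z = y)
      hfr.aemeasurable ?_
    rw [h, ae_dirac_eq]
    exact rfl
  have hsucc : (Kernel.traj (X := fun _ => S) K n y).map (fun ω => ω (n + 1)) = K n y := by
    have h := Kernel.map_traj_succ_self (X := fun _ => S) (κ := K) (a := n)
    rw [← h, Kernel.map_apply _ (measurable_pi_apply _)]
  calc ∫⁻ ω, F (Preorder.frestrictLe n ω) * u (ω (n + 1)) ∂Kernel.traj (X := fun _ => S) K n y
      = ∫⁻ ω, F y * u (ω (n + 1)) ∂Kernel.traj (X := fun _ => S) K n y := by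
        refine lintegral_congr_ae ?_
        filter_upwards [hae] with ω hω
        rw [hω]
    _ = F y * ∫⁻ z, u z ∂K n y := by
        rw [← hsucc, lintegral_map hu (measurable_pi_apply _)]
        exact lintegral_const_mul _ (hu.comp (measurable_pi_apply (n + 1)))

/-- Iterated Markov property. The weight F on the past is arbitrary so that the induction closes:
the constraint at time n is absorbed into the weight, and the remaining ones start at time n + 1. -/
lemma lintegral_mul_stay (A : Set S) (x : S) (k : ℕ) : ∀ (n : ℕ) (F : (Iic n → S) → ℝ≥0∞),
    ∫⁻ ω, F (Preorder.frestrictLe n ω) *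
        {ω : ℕ → S | ∀ i ≤ k, ω (n + i) ∈ A}.indicator 1 ω ∂pathLaw κ x =
      ∫⁻ ω, F (Preorder.frestrictLe n ω) * stayProb κ A k (ω n) ∂pathLaw κ x := by
  induction k with
  | zero =>
    intro n F
    refine lintegral_congr fun ω => ?_
    by_cases h : ω n ∈ A <;> simp [stayProb, h]
  | succ k ih =>
    intro n F
    let G : (Iic (n + 1) → S) → ℝ≥0∞ := fun h =>
      F (fun i => h ⟨i, mem_Iic.2 ((mem_Iic.1 i.2).trans n.le_succ)⟩) *
        A.indicator 1 (h ⟨n, mem_Iic.2 n.le_succ⟩)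
    let G' : (Iic n → S) → ℝ≥0∞ := fun h => F h * A.indicator 1 (h ⟨n, mem_Iic.2 le_rfl⟩)
    have h1 := ih (n + 1) G
    have h2 := lintegral_pathLaw_mul_succ κ x n G' (stayProb κ A k)
    have e1 : ∀ ω : ℕ → S, F (Preorder.frestrictLe n ω) *
        {ω : ℕ → S | ∀ i ≤ k + 1, ω (n + i) ∈ A}.indicator 1 ω =
        G (Preorder.frestrictLe (n + 1) ω) *
          {ω : ℕ → S | ∀ i ≤ k, ω (n + 1 + i) ∈ A}.indicator 1 ω := by
      intro ω
      have hiff : (∀ i ≤ k + 1, ω (n + i) ∈ A) ↔ ω n ∈ A ∧ ∀ i ≤ k, ω (n + 1 + i) ∈ A := by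
        constructor
        · intro h
          refine ⟨h 0 (Nat.zero_le _), fun i hi => ?_⟩
          have := h (i + 1) (by omega)
          rwa [show n + 1 + i = n + (i + 1) by ring]
        · rintro ⟨h0, h⟩ i hi
          rcases i with _ | i
          · exact h0
          · rw [show n + (i + 1) = n + 1 + i by ring]
            exact h i (by omega)
      change _ = F (Preorder.frestrictLe n ω) * A.indicator 1 (ω n) * _
      have hind : {ω : ℕ → S | ∀ i ≤ k + 1, ω (n + i) ∈ A}.indicator (1 : (ℕ → S) → ℝ≥0∞) ω =
          A.indicator 1 (ω n) *
            {ω : ℕ → S | ∀ i ≤ k, ω (n + 1 + i) ∈ A}.indicator 1 ω := by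
        by_cases h : ∀ i ≤ k + 1, ω (n + i) ∈ A
        · rw [Set.indicator_of_mem (Set.mem_ofPred.2 h), Set.indicator_of_mem (hiff.1 h).1,
            Set.indicator_of_mem (Set.mem_ofPred.2 (hiff.1 h).2)]
          simp
        · rw [Set.indicator_of_notMem (mt Set.mem_ofPred.1 h)]
          rw [hiff, not_and_or] at h
          rcases h with h | h
          · rw [Set.indicator_of_notMem h, zero_mul]
          · rw [mul_comm, Set.indicator_of_notMem (mt Set.mem_ofPred.1 h), zero_mul]
      rw [hind, mul_assoc]
    have e2 : ∀ ω : ℕ → S, F (Preorder.frestrictLe n ω) * stayProb κ A (k + 1) (ω n) =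
        G' (Preorder.frestrictLe n ω) * ∫⁻ z, stayProb κ A k z ∂κ (ω n) := by
      intro ω
      change _ = F (Preorder.frestrictLe n ω) * A.indicator 1 (ω n) * _
      by_cases h0 : ω n ∈ A <;> simp [stayProb, h0]
    rw [lintegral_congr e1, lintegral_congr e2, h1, ← h2]
    rfl

lemma pathLaw_stay (A : Set S) (x : S) (n k : ℕ) :
    pathLaw κ x {ω | ∀ i ≤ k, ω (n + i) ∈ A} =
      ∫⁻ ω, stayProb κ A k (ω n) ∂pathLaw κ x := by
  have h := lintegral_mul_stay κ A x k n 1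
  have hm : MeasurableSet {ω : ℕ → S | ∀ i ≤ k, ω (n + i) ∈ A} := by
    simp only [Set.ofPred_forall]
    exact MeasurableSet.iInter fun i => MeasurableSet.iInter fun _ =>
      measurable_pi_apply _ MeasurableSet.of_discrete
  simpa [lintegral_indicator_one hm] using h

end Paths

/-! ### Recurrence from an invariant probability -/

section Invariant

variable [DiscreteMeasurableSpace S] {κ : Kernel S S}

lemma lintegral_pow_succ (n : ℕ) (x : S) (f : S → ℝ≥0∞) :
    ∫⁻ z, f z ∂(κ ^ (n + 1)) x = ∫⁻ y, ∫⁻ z, f z ∂κ y ∂(κ ^ n) x := by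
  rw [pow_succ']
  exact Kernel.lintegral_comp _ _ _ Measurable.of_discrete

lemma pow_mul_pow_le (m n : ℕ) (x y z : S) :
    (κ ^ m) x {y} * (κ ^ n) y {z} ≤ (κ ^ (m + n)) x {z} := by
  rw [Kernel.pow_add_apply_eq_lintegral κ m n x (measurableSet_singleton z)]
  calc (κ ^ m) x {y} * (κ ^ n) y {z} = ∫⁻ b in {y}, (κ ^ n) b {z} ∂(κ ^ m) x := by
        rw [lintegral_singleton, mul_comm]
    _ ≤ _ := setLIntegral_le_lintegral _ _

lemma pow_pos_trans {m n : ℕ} {x y z : S} (h1 : 0 < (κ ^ m) x {y}) (h2 : 0 < (κ ^ n) y {z}) :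
    0 < (κ ^ (m + n)) x {z} :=
  (ENNReal.mul_pos h1.ne' h2.ne').trans_le (pow_mul_pow_le m n x y z)

variable {π : Measure S} [Countable S]

/-- An invariant probability of a chain whose states all communicate charges every state. -/
lemma invariant_pos [IsProbabilityMeasure π] (hπ : Kernel.Invariant κ π)
    (hc : ∀ x y : S, ∃ n : ℕ, 0 < (κ ^ n) x {y}) (y : S) : 0 < π {y} := by
  obtain ⟨x, hx⟩ : ∃ x, 0 < π {x} := by
    by_contra! h
    have : π Set.univ = 0 := by
      rw [← Set.biUnion_of_singleton Set.univ]
      exact (measure_biUnion_null_iff (Set.to_countable _)).2 fun i _ => le_antisymm (h i) zero_le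
    simp at this
  have hinv : ∀ n, Kernel.Invariant (κ ^ n) π := by
    intro n
    induction n with
    | zero => exact Measure.bind_dirac
    | succ n ih => rw [pow_succ]; exact ih.comp hπ
  obtain ⟨n, hn⟩ := hc x y
  rw [← (hinv n).def, Measure.bind_apply (measurableSet_singleton y) (Kernel.aemeasurable _)]
  calc 0 < (κ ^ n) x {y} * π {x} := ENNReal.mul_pos hn.ne' hx.ne'
    _ = ∫⁻ b in {x}, (κ ^ n) b {y} ∂π := by rw [lintegral_singleton]
    _ ≤ _ := setLIntegral_le_lintegral _ _

/-- A bounded nonnegative subharmonic function that vanishes somewhere vanishes everywhere. -/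
lemma eq_zero_of_le_lintegral [IsProbabilityMeasure π] (hπ : Kernel.Invariant κ π)
    (hc : ∀ x y : S, ∃ n : ℕ, 0 < (κ ^ n) x {y}) {R : S → ℝ≥0∞} (hR1 : ∀ x, R x ≤ 1)
    (hR : ∀ x, R x ≤ ∫⁻ z, R z ∂κ x) {y : S} (hy : R y = 0) (z : S) : R z = 0 := by
  have hfin : ∫⁻ x, R x ∂π ≠ ∞ := by
    refine ne_top_of_le_ne_top ENNReal.one_ne_top ((lintegral_mono hR1).trans ?_)
    simp
  have hint : ∫⁻ x, ∫⁻ z, R z ∂κ x ∂π ≤ ∫⁻ x, R x ∂π := by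
    conv_rhs => rw [← hπ.def]
    rw [Measure.lintegral_bind (Kernel.aemeasurable _) Measurable.of_discrete.aemeasurable]
  -- `R` is dominated by its image under `κ`, yet invariance gives both the same finite integral.
  -- They agree π-almost everywhere, hence everywhere, because π charges each state.
  have hae := ae_eq_of_ae_le_of_lintegral_le (ae_of_all π hR) hfin
    Measurable.of_discrete.aemeasurable hint
  have heq : ∀ x, ∫⁻ z, R z ∂κ x = R x := by
    intro x
    by_contra h
    refine (invariant_pos hπ hc x).ne' (measure_mono_null ?_ (ae_iff.1 hae))
    rintro _ rfl
    exact fun h' => h h'.symm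
  have hpow : ∀ n, ∫⁻ z, R z ∂(κ ^ n) y = 0 := by
    intro n
    induction n with
    | zero =>
      change ∫⁻ z, R z ∂Measure.dirac y = 0
      rw [lintegral_dirac, hy]
    | succ n ih => rw [lintegral_pow_succ, lintegral_congr heq, ih]
  obtain ⟨n, hn⟩ := hc y z
  have h0 : R z * (κ ^ n) y {z} ≤ 0 := by
    rw [← hpow n, ← lintegral_singleton]
    exact setLIntegral_le_lintegral _ _
  exact (mul_eq_zero.1 (le_antisymm h0 zero_le)).resolve_right hn.ne'

variable [IsMarkovKernel κ]

/-- In a chain with an invariant probability whose states all communicate, every state is visited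
infinitely often from every initial state. -/
lemma ae_frequently_eq [IsProbabilityMeasure π] (hπ : Kernel.Invariant κ π)
    (hc : ∀ x y : S, ∃ n : ℕ, 0 < (κ ^ n) x {y}) (x y : S) :
    ∀ᵐ ω ∂pathLaw κ x, ∃ᶠ n in atTop, ω n = y := by
  set A : Set S := {y}ᶜ with hA
  have hanti := stayProb_antitone κ A
  -- The infimum is the probability of never meeting y. It is subharmonic because the indicator in
  -- `stayProb` only lowers the value, and it is zero at y itself.
  have hlim : ∀ z, ⨅ k, stayProb κ A k z = 0 := by
    refine eq_zero_of_le_lintegral hπ hc (fun z => (iInf_le _ 0).trans (stayProb_le_one κ A 0 z))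
      (fun z => ?_) (y := y) ?_
    · rw [lintegral_iInf (fun _ => Measurable.of_discrete) hanti]
      · refine le_iInf fun k => (iInf_le _ (k + 1)).trans ?_
        exact Set.indicator_le_self _ _ z
      · refine ne_top_of_le_ne_top ENNReal.one_ne_top
          ((lintegral_mono (stayProb_le_one κ A 0)).trans ?_)
        simp
    · exact le_antisymm ((iInf_le _ 0).trans (by simp [stayProb, hA])) zero_le
  have hnull : ∀ n, pathLaw κ x {ω | ∀ i, ω (n + i) ≠ y} = 0 := by
    intro n
    have hle : ∀ k, pathLaw κ x {ω | ∀ i, ω (n + i) ≠ y} ≤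
        ∫⁻ ω, stayProb κ A k (ω n) ∂pathLaw κ x := fun k => by
      rw [← pathLaw_stay]
      exact measure_mono fun ω h i _ => h i
    refine le_antisymm ((le_iInf hle).trans ?_) zero_le
    rw [← lintegral_iInf (f := fun k (ω : ℕ → S) => stayProb κ A k (ω n))
      (fun k => (Measurable.of_discrete (f := stayProb κ A k)).comp (measurable_pi_apply n))
      (fun i j hij (ω : ℕ → S) => hanti hij (ω n))]
    · simp [hlim]
    · refine ne_top_of_le_ne_top ENNReal.one_ne_top
        ((lintegral_mono fun ω : ℕ → S => stayProb_le_one κ A 0 (ω n)).trans ?_)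
      simp
  have hall : ∀ᵐ ω ∂pathLaw κ x, ∀ n, ∃ i, ω (n + i) = y := by
    rw [ae_all_iff]
    intro n
    rw [ae_iff]
    simpa using hnull n
  filter_upwards [hall] with ω hω
  rw [frequently_atTop]
  intro n
  obtain ⟨i, hi⟩ := hω n
  exact ⟨n + i, Nat.le_add_right _ _, hi⟩

/-- A Dirac mass serves as irreducibility measure. Any set charged by some measure is nonempty, so
recurrence reduces to infinitely many visits to one of its states. -/
lemma isPositiveHarris_of_communicates [Nonempty S] [IsProbabilityMeasure π]
    (hπ : Kernel.Invariant κ π) (hc : ∀ x y : S, ∃ n : ℕ, 0 < (κ ^ n) x {y}) :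
    IsPositiveHarris κ where
  irreducible := by
    obtain ⟨y⟩ := ‹Nonempty S›
    refine ⟨Measure.dirac y, inferInstance, (inferInstance : NeZero (Measure.dirac y)).out,
      ⟨fun A hA hpos x => ?_⟩⟩
    obtain ⟨n, hn⟩ := hc x y
    refine ⟨n, hn.trans_le (measure_mono (Set.singleton_subset_iff.2 ?_))⟩
    by_contra h
    simp [h] at hpos
  recurrent := by
    intro φ _ _ A _ hpos x
    obtain ⟨y, hy⟩ := nonempty_of_measure_ne_zero hpos.ne'
    filter_upwards [ae_frequently_eq hπ hc x y] with ω hω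
    exact hω.mono fun n hn => hn ▸ hy
  positive := ⟨π, inferInstance, hπ⟩

end Invariant

end MarkovChain

namespace MarkovChain

variable {S : Type*} [MeasurableSpace S]

/-! ### Foster's criterion -/

section Drift

variable [DiscreteMeasurableSpace S] {κ : Kernel S S} [IsMarkovKernel κ]

instance isMarkovKernel_pow (n : ℕ) : IsMarkovKernel (κ ^ n) := by
  induction n with
  | zero => exact (inferInstance : IsMarkovKernel (Kernel.id : Kernel S S))
  | succ n ih => rw [pow_succ']; exact Kernel.IsMarkovKernel.comp κ (κ ^ n)

/-- Iterating the drift inequality bounds the occupation times of `B` from below. -/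
lemma le_occupation_of_drift {W : S → ℝ≥0∞} {b : ℝ≥0∞} {B : Set S}
    (h : ∀ x, ∫⁻ z, W z ∂κ x + 1 ≤ W x + b * B.indicator 1 x) (x : S) (n : ℕ) :
    ∫⁻ z, W z ∂(κ ^ n) x + n ≤ W x + b * ∑ k ∈ range n, (κ ^ k) x B := by
  induction n with
  | zero =>
    change ∫⁻ z, W z ∂Measure.dirac x + _ ≤ _
    simp
  | succ n ih =>
    have hstep : ∫⁻ z, W z ∂(κ ^ (n + 1)) x + 1 ≤
        ∫⁻ z, W z ∂(κ ^ n) x + b * (κ ^ n) x B := by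
      have := lintegral_mono (μ := (κ ^ n) x) h
      rwa [lintegral_add_left Measurable.of_discrete, lintegral_add_left Measurable.of_discrete,
        lintegral_const_mul _ Measurable.of_discrete,
        lintegral_indicator_one MeasurableSet.of_discrete, lintegral_one, measure_univ,
        ← lintegral_pow_succ] at this
    calc ∫⁻ z, W z ∂(κ ^ (n + 1)) x + (n + 1 : ℕ)
        = (∫⁻ z, W z ∂(κ ^ (n + 1)) x + 1) + n := by push_cast; ring
      _ ≤ (∫⁻ z, W z ∂(κ ^ n) x + b * (κ ^ n) x B) + n := by gcongr
      _ = (∫⁻ z, W z ∂(κ ^ n) x + n) + b * (κ ^ n) x B := by ring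
      _ ≤ (W x + b * ∑ k ∈ range n, (κ ^ k) x B) + b * (κ ^ n) x B := by gcongr
      _ = _ := by rw [sum_range_succ]; ring

/-- Cesàro average of the laws at the times `0, …, n`. -/
def cesaroLaw (κ : Kernel S S) (x : S) (n : ℕ) : Measure S :=
  ((n + 1 : ℕ) : ℝ≥0∞)⁻¹ • ∑ k ∈ range (n + 1), (κ ^ k) x

instance (x : S) (n : ℕ) : IsProbabilityMeasure (cesaroLaw κ x n) where
  measure_univ := by
    simp only [cesaroLaw, Measure.smul_apply, Measure.finsetSum_apply, measure_univ, smul_eq_mul,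
      sum_const, card_range, nsmul_eq_mul, mul_one]
    exact ENNReal.inv_mul_cancel (by simp) (by simp)

/-- One more step shifts the sum of laws by one index, which adds a single term of mass at most one.
-/
lemma lintegral_cesaroLaw_le (x z : S) (n : ℕ) :
    ∫⁻ y, κ y {z} ∂cesaroLaw κ x n ≤ cesaroLaw κ x n {z} + ((n + 1 : ℕ) : ℝ≥0∞)⁻¹ := by
  have h1 : ∀ k, ∫⁻ y, κ y {z} ∂(κ ^ k) x = (κ ^ (k + 1)) x {z} := fun k =>
    (Kernel.pow_succ_apply_eq_lintegral κ k x (measurableSet_singleton z)).symm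
  simp only [cesaroLaw, lintegral_smul_measure, lintegral_finsetSum_measure, h1,
    Measure.smul_apply, Measure.finsetSum_apply, smul_eq_mul]
  calc ((n + 1 : ℕ) : ℝ≥0∞)⁻¹ * ∑ k ∈ range (n + 1), (κ ^ (k + 1)) x {z}
      ≤ ((n + 1 : ℕ) : ℝ≥0∞)⁻¹ * (∑ k ∈ range (n + 1), (κ ^ k) x {z} + 1) := by
        gcongr
        calc ∑ k ∈ range (n + 1), (κ ^ (k + 1)) x {z}
            ≤ ∑ k ∈ range (n + 1 + 1), (κ ^ k) x {z} := by
              rw [sum_range_succ' _ (n + 1)]; exact le_self_add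
          _ ≤ _ := by rw [sum_range_succ _ (n + 1)]; gcongr; exact prob_le_one
    _ = _ := by rw [mul_add, mul_one]

variable [Countable S]

/-- A nonzero finite measure with `μ κ ≤ μ` normalizes to an invariant probability. -/
lemma exists_invariant_of_bind_le {μ : Measure S} [IsFiniteMeasure μ] (h0 : μ ≠ 0)
    (h : ∀ z, ∫⁻ y, κ y {z} ∂μ ≤ μ {z}) :
    ∃ π : Measure S, IsProbabilityMeasure π ∧ Kernel.Invariant κ π := by
  -- A Markov kernel preserves total mass, and a measure dominated by another of the same finite
  -- mass is equal to it.
  have hbind : μ.bind κ = μ := by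
    have huniv : (μ.bind κ) Set.univ = μ Set.univ := by
      rw [Measure.bind_apply MeasurableSet.univ (Kernel.aemeasurable _)]
      simp
    have : IsFiniteMeasure (μ.bind κ) := ⟨by rw [huniv]; exact measure_lt_top _ _⟩
    refine Measure.eq_of_le_of_measure_univ_eq (Measure.le_iff.2 fun s hs => ?_) huniv
    rw [← Measure.tsum_indicator_apply_singleton _ s hs,
      ← Measure.tsum_indicator_apply_singleton μ s hs]
    refine ENNReal.tsum_le_tsum fun z => Set.indicator_le_indicator ?_
    rw [Measure.bind_apply (measurableSet_singleton z) (Kernel.aemeasurable _)]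
    exact h z
  have : NeZero μ := ⟨h0⟩
  refine ⟨(μ Set.univ)⁻¹ • μ, inferInstance, ?_⟩
  ext s hs
  rw [Measure.bind_apply hs (Kernel.aemeasurable _), lintegral_smul_measure,
    ← Measure.bind_apply hs (Kernel.aemeasurable _), hbind, Measure.smul_apply]

/-- Foster's criterion: a drift condition towards a finite set yields an invariant probability. -/
theorem exists_invariant_of_drift [Nonempty S] {W : S → ℝ≥0∞} (hW : ∀ x, W x ≠ ∞) {b : ℝ≥0∞}
    (hb : b ≠ ∞) {B : Finset S}
    (h : ∀ x, ∫⁻ z, W z ∂κ x + 1 ≤ W x + b * (B : Set S).indicator 1 x) :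
    ∃ π : Measure S, IsProbabilityMeasure π ∧ Kernel.Invariant κ π := by
  obtain ⟨x⟩ := ‹Nonempty S›
  -- The product of copies of [0, ∞] over the countable set `S` is sequentially compact. Tightness
  -- is not needed: mass may escape in the limit, provided some remains.
  obtain ⟨p, φ, hφ, hp⟩ :=
    CompactSpace.tendsto_subseq (fun n => fun y => cesaroLaw κ x n {y} : ℕ → S → ℝ≥0∞)
  rw [tendsto_pi_nhds] at hp
  have hinv : Tendsto (fun n => ((φ n + 1 : ℕ) : ℝ≥0∞)⁻¹) atTop (𝓝 0) :=
    ((ENNReal.tendsto_inv_nat_nhds_zero.comp (tendsto_add_atTop_nat 1))).comp hφ.tendsto_atTop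
  have hsum : ∀ n (F : Finset S), ∑ y ∈ F, cesaroLaw κ x n {y} = cesaroLaw κ x n F :=
    fun n F => sum_measure_singleton
  have htot : ∑' y, p y ≤ 1 := by
    rw [ENNReal.tsum_eq_iSup_sum]
    refine iSup_le fun F => le_of_tendsto (tendsto_finsetSum F fun y _ => hp y)
      (Eventually.of_forall fun n => ?_)
    simp only [Function.comp_apply, hsum]
    exact prob_le_one
  -- The occupation bound divided by n + 1 survives the limit because `B` is finite. It shows that
  -- the limit p is not zero.
  have hB : 1 ≤ b * ∑ y ∈ B, p y := by
    have hlow : ∀ n : ℕ, 1 ≤ W x * ((n + 1 : ℕ) : ℝ≥0∞)⁻¹ + b * ∑ y ∈ B, cesaroLaw κ x n {y} := by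
      intro n
      have h1 := le_occupation_of_drift h x (n + 1)
      have h2 : ((n + 1 : ℕ) : ℝ≥0∞) ≤ W x + b * ∑ k ∈ range (n + 1), (κ ^ k) x B :=
        le_add_self.trans h1
      calc (1 : ℝ≥0∞) = ((n + 1 : ℕ) : ℝ≥0∞) * ((n + 1 : ℕ) : ℝ≥0∞)⁻¹ :=
            (ENNReal.mul_inv_cancel (by simp) (by simp)).symm
        _ ≤ (W x + b * ∑ k ∈ range (n + 1), (κ ^ k) x B) * ((n + 1 : ℕ) : ℝ≥0∞)⁻¹ := by gcongr
        _ = _ := by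
          rw [hsum]
          simp only [cesaroLaw, Measure.smul_apply, Measure.finsetSum_apply, smul_eq_mul]
          ring
    have hlim : Tendsto (fun n => W x * ((φ n + 1 : ℕ) : ℝ≥0∞)⁻¹ +
        b * ∑ y ∈ B, cesaroLaw κ x (φ n) {y}) atTop (𝓝 (W x * 0 + b * ∑ y ∈ B, p y)) :=
      (ENNReal.Tendsto.const_mul hinv (Or.inr (hW x))).add
        (ENNReal.Tendsto.const_mul (tendsto_finsetSum B fun y _ => hp y) (Or.inr hb))
    have := ge_of_tendsto' hlim fun n => hlow (φ n)
    simpa using this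
  -- Only finite partial sums pass to the limit, as in Fatou's lemma, so invariance is obtained as
  -- an inequality first.
  have hsub : ∀ z, ∑' y, κ y {z} * p y ≤ p z := by
    intro z
    rw [ENNReal.tsum_eq_iSup_sum]
    refine iSup_le fun F => ?_
    have h1 : Tendsto (fun n => ∑ y ∈ F, κ y {z} * cesaroLaw κ x (φ n) {y}) atTop
        (𝓝 (∑ y ∈ F, κ y {z} * p y)) :=
      tendsto_finsetSum F fun y _ => ENNReal.Tendsto.const_mul (hp y)
        (Or.inr (measure_ne_top _ _))
    have h2 : Tendsto (fun n => cesaroLaw κ x (φ n) {z} + ((φ n + 1 : ℕ) : ℝ≥0∞)⁻¹) atTop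
        (𝓝 (p z + 0)) := (hp z).add hinv
    rw [add_zero] at h2
    refine le_of_tendsto_of_tendsto' h1 h2 fun n => ?_
    refine le_trans ?_ (lintegral_cesaroLaw_le x z (φ n))
    rw [lintegral_countable']
    exact ENNReal.sum_le_tsum F
  set μ : Measure S := Measure.sum fun y => p y • Measure.dirac y with hμ
  have hμs : ∀ y, μ {y} = p y := fun y => Measure.sum_smul_dirac_singleton
  have hfin : IsFiniteMeasure μ := ⟨by
    rw [hμ, Measure.sum_apply _ MeasurableSet.univ]
    simpa using htot.trans_lt ENNReal.one_lt_top⟩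
  refine exists_invariant_of_bind_le (μ := μ) (fun h0 => ?_) fun z => ?_
  · have : ∀ y, p y = 0 := fun y => by rw [← hμs, h0]; simp
    simp [this] at hB
  · rw [lintegral_countable', hμs]
    simpa only [hμs] using hsub z

end Drift

end MarkovChain

namespace MarkovChain

variable {S : Type*} [MeasurableSpace S]

lemma abs_tsum_le_tsum_abs {ι : Type*} {f : ι → ℝ} (hf : Summable fun i => |f i|) :
    |∑' i, f i| ≤ ∑' i, |f i| := by
  simp only [← Real.norm_eq_abs] at hf ⊢
  exact norm_tsum_le_tsum_norm hf

/-! ### Total variation and the ℓ¹ distance -/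

section TotalVariation

lemma tvDist_nonneg (μ ν : Measure S) : 0 ≤ tvDist μ ν :=
  Real.iSup_nonneg fun _ => abs_nonneg _

variable [Countable S] [DiscreteMeasurableSpace S]

lemma hasSum_indicator_real (μ : Measure S) [IsFiniteMeasure μ] (A : Set S) :
    HasSum (fun y => A.indicator (fun y => μ.real {y}) y) (μ.real A) := by
  have hA : MeasurableSet A := MeasurableSet.of_discrete
  have h := Measure.tsum_indicator_apply_singleton μ A hA
  have hne : ∑' y, A.indicator (fun y => μ {y}) y ≠ ∞ := h ▸ measure_ne_top _ _
  have hs := ENNReal.hasSum_toReal hne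
  rw [← ENNReal.tsum_toReal_eq (fun y => ENNReal.ne_top_of_tsum_ne_top hne y), h] at hs
  have e : (fun y => A.indicator (fun y => μ.real {y}) y) =
      fun y => (A.indicator (fun y => μ {y}) y).toReal := by
    funext y
    by_cases hy : y ∈ A <;> simp [hy, Measure.real]
  rw [e]
  exact hs

lemma hasSum_measureReal (μ : Measure S) [IsFiniteMeasure μ] :
    HasSum (fun y => μ.real {y}) (μ.real Set.univ) := by
  simpa using hasSum_indicator_real μ Set.univ

lemma summable_sub_real (μ ν : Measure S) [IsFiniteMeasure μ] [IsFiniteMeasure ν] :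
    Summable fun y => μ.real {y} - ν.real {y} :=
  (hasSum_measureReal μ).summable.sub (hasSum_measureReal ν).summable

lemma tvDist_le_tsum (μ ν : Measure S) [IsFiniteMeasure μ] [IsFiniteMeasure ν] :
    tvDist μ ν ≤ ∑' y, |μ.real {y} - ν.real {y}| := by
  have hs := (summable_sub_real μ ν).abs
  have : Nonempty {A : Set S // MeasurableSet A} := ⟨⟨∅, MeasurableSet.empty⟩⟩
  unfold tvDist
  refine ciSup_le fun A => ?_
  have hd := (hasSum_indicator_real μ A.1).sub (hasSum_indicator_real ν A.1)
  have hle : ∀ y, |A.1.indicator (fun y => μ.real {y}) y - A.1.indicator (fun y => ν.real {y}) y| ≤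
      |μ.real {y} - ν.real {y}| := by
    intro y
    by_cases hy : y ∈ A.1 <;> simp [hy]
  have habs := Summable.of_nonneg_of_le (fun y => abs_nonneg _) hle hs
  rw [← hd.tsum_eq]
  refine le_trans ?_ (habs.tsum_le_tsum hle hs)
  exact abs_tsum_le_tsum_abs habs

end TotalVariation

/-! ### Kernels acting on summable densities -/

section Push

variable [Countable S] [DiscreteMeasurableSpace S] (κ : Kernel S S) [IsMarkovKernel κ]

/-- Action of a kernel on summable functions, seen as densities with respect to counting measure. -/
def push (s : S → ℝ) (y : S) : ℝ := ∑' x, s x * (κ x).real {y}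

lemma hasSum_mul_real (s : S → ℝ) (x : S) : HasSum (fun y => s x * (κ x).real {y}) (s x) := by
  simpa using (hasSum_measureReal (κ x)).mul_left (s x)

variable {κ} {s : S → ℝ}

lemma summable_prod_mul_real (hs : Summable s) :
    Summable fun p : S × S => s p.1 * (κ p.1).real {p.2} := by
  refine Summable.of_abs ?_
  simp only [abs_mul, abs_of_nonneg measureReal_nonneg]
  refine (summable_prod_of_nonneg fun p => by positivity).2
    ⟨fun x => (hasSum_mul_real κ (fun x => |s x|) x).summable, ?_⟩
  simpa only [(hasSum_mul_real κ (fun x => |s x|) _).tsum_eq] using hs.abs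

lemma summable_mul_real (hs : Summable s) (y : S) :
    Summable fun x => s x * (κ x).real {y} := by
  have hi : Function.Injective fun x : S => (x, y) := fun _ _ h => congrArg Prod.fst h
  simpa only [Function.comp_def] using (summable_prod_mul_real (κ := κ) hs).comp_injective hi

lemma summable_push (hs : Summable s) : Summable (push κ s) :=
  (summable_prod_mul_real (κ := κ) hs).prod_symm.prod

lemma tsum_push (hs : Summable s) : ∑' y, push κ s y = ∑' x, s x := by
  have h := Summable.tsum_comm (f := fun x y => s x * (κ x).real {y})
    (summable_prod_mul_real (κ := κ) hs)
  simp only [(hasSum_mul_real κ s _).tsum_eq] at h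
  exact h

/-- For ε = ±1 the factor |s| + εs is nonnegative, so this one identity yields both halves of |push
s| ≤ push |s|, and strictness wherever a positive term occurs. -/
lemma push_abs_add (hs : Summable s) (y : S) (ε : ℝ) :
    push κ (fun x => |s x|) y + ε * push κ s y = ∑' x, (|s x| + ε * s x) * (κ x).real {y} := by
  unfold push
  rw [← tsum_mul_left, ← (summable_mul_real hs.abs y).tsum_add ((summable_mul_real hs y).mul_left _)]
  exact tsum_congr fun x => by ring

lemma push_abs_add_nonneg (hs : Summable s) (y : S) {ε : ℝ} (hε : |ε| = 1) :
    0 ≤ push κ (fun x => |s x|) y + ε * push κ s y := by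
  rw [push_abs_add hs]
  refine tsum_nonneg fun x => mul_nonneg ?_ measureReal_nonneg
  have := neg_abs_le (ε * s x)
  rw [abs_mul, hε, one_mul] at this
  linarith

lemma push_abs_add_pos (hs : Summable s) (y : S) {ε : ℝ} (hε : |ε| = 1) {x : S}
    (hx : 0 < ε * s x) (hκ : 0 < (κ x).real {y}) :
    0 < push κ (fun x => |s x|) y + ε * push κ s y := by
  rw [push_abs_add hs]
  have hnn : ∀ x, 0 ≤ (|s x| + ε * s x) * (κ x).real {y} := fun x => by
    refine mul_nonneg ?_ measureReal_nonneg
    have := neg_abs_le (ε * s x)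
    rw [abs_mul, hε, one_mul] at this
    linarith
  have hsum : Summable fun x => (|s x| + ε * s x) * (κ x).real {y} := by
    refine ((summable_mul_real (κ := κ) hs.abs y).add
      ((summable_mul_real (κ := κ) hs y).mul_left ε)).congr fun x => by ring
  refine hsum.tsum_pos hnn x (mul_pos ?_ hκ)
  positivity

lemma abs_push_le (hs : Summable s) (y : S) : |push κ s y| ≤ push κ (fun x => |s x|) y := by
  have h1 := push_abs_add_nonneg (κ := κ) hs y (ε := 1) (by simp)
  have h2 := push_abs_add_nonneg (κ := κ) hs y (ε := -1) (by simp)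
  exact abs_le.2 ⟨by linarith, by linarith⟩

lemma tsum_abs_push_le (hs : Summable s) : ∑' y, |push κ s y| ≤ ∑' x, |s x| := by
  rw [← tsum_push (κ := κ) hs.abs]
  exact (summable_push hs).abs.tsum_le_tsum (abs_push_le hs) (summable_push hs.abs)

/-- Mass of opposite signs that meets at `z` is cancelled. -/
lemma tsum_abs_push_lt (hs : Summable s) {x y z : S} (hx : 0 < s x) (hy : s y < 0)
    (hxz : 0 < (κ x).real {z}) (hyz : 0 < (κ y).real {z}) :
    ∑' y, |push κ s y| < ∑' x, |s x| := by
  rw [← tsum_push (κ := κ) hs.abs]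
  refine Summable.tsum_lt_tsum (abs_push_le hs) (i := z) ?_ (summable_push hs).abs
    (summable_push hs.abs)
  have h1 := push_abs_add_pos (κ := κ) hs z (ε := 1) (by simp) (x := x) (by simpa) hxz
  have h2 := push_abs_add_pos (κ := κ) hs z (ε := -1) (by simp) (x := y) (by simpa) hyz
  exact abs_lt.2 ⟨by linarith, by linarith⟩

lemma push_measureReal (μ : Measure S) [IsFiniteMeasure μ] (y : S) :
    push κ (fun x => μ.real {x}) y = (μ.bind κ).real {y} := by
  rw [Measure.real, Measure.bind_apply (measurableSet_singleton y) (Kernel.aemeasurable _),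
    lintegral_countable', ENNReal.tsum_toReal_eq
      fun x => ENNReal.mul_ne_top (measure_ne_top _ _) (measure_ne_top _ _)]
  refine tsum_congr fun x => ?_
  rw [ENNReal.toReal_mul, mul_comm]
  rfl

lemma push_sub_measureReal (μ ν : Measure S) [IsFiniteMeasure μ] [IsFiniteMeasure ν] (y : S) :
    push κ (fun x => μ.real {x} - ν.real {x}) y =
      (μ.bind κ).real {y} - (ν.bind κ).real {y} := by
  rw [← push_measureReal, ← push_measureReal]
  unfold push
  rw [← (summable_mul_real (hasSum_measureReal μ).summable y).tsum_sub
    (summable_mul_real (hasSum_measureReal ν).summable y)]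
  exact tsum_congr fun x => by ring

end Push

/-! ### Convergence to the invariant probability -/

section Convergence

variable {κ : Kernel S S}

lemma invariant_pow {π : Measure S} (hπ : Kernel.Invariant κ π) (n : ℕ) :
    Kernel.Invariant (κ ^ n) π := by
  induction n with
  | zero => exact Measure.bind_dirac
  | succ n ih => rw [pow_succ]; exact ih.comp hπ

lemma pow_bind_pow (x : S) (n m : ℕ) : ((κ ^ n) x).bind (κ ^ m) = (κ ^ (n + m)) x := by
  rw [add_comm, pow_add]
  exact (Kernel.comp_apply _ _ _).symm

lemma averagedLaw_apply (d n : ℕ) (x : S) (A : Set S) :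
    averagedLaw κ d n x A = (d : ℝ≥0∞)⁻¹ * ∑ r ∈ range d, (κ ^ (n + r)) x A := by
  simp [averagedLaw, Measure.finsetSum_apply]

lemma averagedLaw_bind_pow (d n m : ℕ) (x : S) :
    (averagedLaw κ d n x).bind (κ ^ m) = averagedLaw κ d (n + m) x := by
  ext A hA
  rw [Measure.bind_apply hA (Kernel.aemeasurable _), averagedLaw, lintegral_smul_measure,
    lintegral_finsetSum_measure, averagedLaw_apply, smul_eq_mul]
  congr 1
  refine sum_congr rfl fun r _ => ?_
  rw [← Measure.bind_apply hA (Kernel.aemeasurable _), pow_bind_pow,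
    show n + r + m = n + m + r by ring]

/-- Invariance under `κ ^ n` gives π{y} ≥ π{x} κⁿ(x, {y}), by keeping only the contribution of the
starting point x. -/
lemma pow_le_inv_mul_invariant [MeasurableSingletonClass S] {π : Measure S} [IsFiniteMeasure π]
    (hπ : Kernel.Invariant κ π) {x : S} (hx : 0 < π {x}) (n : ℕ)
    (y : S) : (κ ^ n) x {y} ≤ (π {x})⁻¹ * π {y} := by
  rw [mul_comm, ← div_eq_mul_inv, ENNReal.le_div_iff_mul_le (Or.inl hx.ne')
    (Or.inl (measure_ne_top _ _)), ← lintegral_singleton (f := fun b => (κ ^ n) b {y})]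
  conv_rhs => rw [← (invariant_pow hπ n).def, Measure.bind_apply (measurableSet_singleton y)
    (Kernel.aemeasurable _)]
  exact setLIntegral_le_lintegral _ _

variable [IsMarkovKernel κ]

lemma isProbabilityMeasure_averagedLaw {d : ℕ} (hd : d ≠ 0) (n : ℕ) (x : S) :
    IsProbabilityMeasure (averagedLaw κ d n x) where
  measure_univ := by
    rw [averagedLaw_apply]
    simpa using ENNReal.inv_mul_cancel (by simpa using hd) (by simp)

variable [Countable S] [DiscreteMeasurableSpace S]
  {π : Measure S} [IsProbabilityMeasure π]

/-- A signed density of zero mass on both classes `{χ = 1}` and `{χ = -1}`, whose total variation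
is preserved by all powers of a chain that couples any two states of the same class, vanishes. -/
lemma eq_zero_of_tsum_abs_push_eq {χ : S → ℝ} (hχ : ∀ y, χ y = 1 ∨ χ y = -1)
    (hcoal : ∀ y z, χ y = χ z → ∃ m x, 0 < (κ ^ m) y {x} ∧ 0 < (κ ^ m) z {x})
    {h : S → ℝ} (hs : Summable h) (h0 : ∑' y, h y = 0) (hχ0 : ∑' y, h y * χ y = 0)
    (hpush : ∀ m, ∑' y, |push (κ ^ m) h y| = ∑' y, |h y|) (y : S) : h y = 0 := by
  -- Opposite signs in one class would meet at a common state and strictly lower the ℓ¹ norm.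
  have hsign : ∀ y z, χ y = χ z → 0 < h y → ¬ h z < 0 := by
    intro y z hyz hy hz
    obtain ⟨m, x, h1, h2⟩ := hcoal y z hyz
    exact (tsum_abs_push_lt (κ := κ ^ m) hs hy hz (ENNReal.toReal_pos h1.ne' (measure_ne_top _ _))
      (ENNReal.toReal_pos h2.ne' (measure_ne_top _ _))).ne (hpush m)
  have hsχ : Summable fun y => h y * χ y := by
    refine Summable.of_abs (hs.abs.congr fun y => ?_)
    rcases hχ y with e | e <;> simp [e]
  have hclass : ∀ ε : ℝ, (ε = 1 ∨ ε = -1) → ∀ y, χ y = ε → h y = 0 := by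
    intro ε hε y hy
    -- `g` is 2h on the class {χ = ε} and 0 off it. It has a constant sign and zero sum, hence
    -- vanishes.
    set g : S → ℝ := fun y => h y + ε * (h y * χ y) with hg
    have hgs : Summable g := hs.add (hsχ.mul_left ε)
    have hg0 : ∑' y, g y = 0 := by
      rw [hs.tsum_add (hsχ.mul_left ε), tsum_mul_left, h0, hχ0]; simp
    have hgval : ∀ z, χ z = ε → g z = 2 * h z := by
      intro z hz
      rcases hε with e | e <;> simp only [hg, hz, e] <;> ring
    have hgval' : ∀ z, χ z ≠ ε → g z = 0 := by
      intro z hz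
      rcases hε with e | e <;> rcases hχ z with e' | e' <;> simp_all
    rcases lt_trichotomy (h y) 0 with hy0 | hy0 | hy0
    · have hnn : ∀ z, 0 ≤ -g z := by
        intro z
        by_cases hz : χ z = ε
        · rw [hgval z hz]
          have := mt (hsign z y (hz.trans hy.symm)) (not_not.2 hy0)
          linarith
        · rw [hgval' z hz]; simp
      have hp := hgs.neg.tsum_pos hnn y (by rw [hgval y hy]; linarith)
      rw [tsum_neg, hg0] at hp
      simp at hp
    · exact hy0
    · have hnn : ∀ z, 0 ≤ g z := by
        intro z
        by_cases hz : χ z = ε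
        · rw [hgval z hz]
          have := hsign y z (hy.trans hz.symm) hy0
          linarith
        · rw [hgval' z hz]
      have hp := hgs.tsum_pos hnn y (by rw [hgval y hy]; linarith)
      rw [hg0] at hp
      exact absurd hp (lt_irrefl _)
  rcases hχ y with e | e
  · exact hclass 1 (Or.inl rfl) y e
  · exact hclass (-1) (Or.inr rfl) y e

/-- Convergence in `ℓ¹` of laws dominated by the invariant probability. -/
lemma tendsto_tsum_abs_sub (hπ : Kernel.Invariant κ π) {χ : S → ℝ}
    (hχ : ∀ y, χ y = 1 ∨ χ y = -1)
    (hcoal : ∀ y z, χ y = χ z → ∃ m x, 0 < (κ ^ m) y {x} ∧ 0 < (κ ^ m) z {x})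
    {μ : ℕ → Measure S} [∀ n, IsProbabilityMeasure (μ n)]
    (hμ : ∀ n m : ℕ, (μ n).bind (κ ^ m) = μ (n + m))
    {C : ℝ} (hC : ∀ n y, (μ n).real {y} ≤ C * π.real {y})
    (hμχ : ∀ n, ∫ y, χ y ∂μ n = ∫ y, χ y ∂π) :
    Tendsto (fun n => ∑' y, |(μ n).real {y} - π.real {y}|) atTop (𝓝 0) := by
  set s : ℕ → S → ℝ := fun n y => (μ n).real {y} - π.real {y} with hs
  have hsum : ∀ n, Summable (s n) := fun n => summable_sub_real (μ n) π
  set D : S → ℝ := fun y => (C + 1) * π.real {y} with hD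
  have hDsum : Summable D := (hasSum_measureReal π).summable.mul_left _
  have hsD : ∀ n y, |s n y| ≤ D y := by
    intro n y
    have h1 : 0 ≤ (μ n).real {y} := measureReal_nonneg
    have h2 : 0 ≤ π.real {y} := measureReal_nonneg
    have h3 := hC n y
    refine abs_le.2 ⟨?_, ?_⟩ <;> simp only [hs, hD] <;> linarith
  have hpush : ∀ n m, s (n + m) = push (κ ^ m) (s n) := by
    intro n m
    funext y
    change _ = push (κ ^ m) (fun x => (μ n).real {x} - π.real {x}) y
    rw [push_sub_measureReal, hμ, (invariant_pow hπ m).def]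
  have hanti : Antitone fun n => ∑' y, |s n y| := by
    refine antitone_nat_of_succ_le fun n => ?_
    rw [hpush n 1]
    exact tsum_abs_push_le (hsum n)
  obtain ⟨l, hl⟩ : ∃ l, Tendsto (fun n => ∑' y, |s n y|) atTop (𝓝 l) :=
    ⟨_, tendsto_atTop_ciInf hanti ⟨0, by rintro _ ⟨n, rfl⟩; exact tsum_nonneg fun _ => abs_nonneg _⟩⟩
  -- Domination by `D` puts all differences in a compact box, and summability of `D` upgrades
  -- pointwise limits to limits of sums.
  have hcpt : IsCompact (Set.univ.pi fun y => Set.Icc (-D y) (D y)) :=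
    isCompact_univ_pi fun y => isCompact_Icc
  obtain ⟨h, hh, φ, hφ, hlim⟩ := hcpt.tendsto_subseq (x := s)
    fun n y _ => abs_le.1 (hsD n y)
  have hhD : ∀ y, |h y| ≤ D y := fun y => abs_le.2 (hh y trivial)
  have hhsum : Summable h := Summable.of_abs
    (Summable.of_nonneg_of_le (fun _ => abs_nonneg _) hhD hDsum)
  rw [tendsto_pi_nhds] at hlim
  have habs : Tendsto (fun k => ∑' y, |s (φ k) y|) atTop (𝓝 (∑' y, |h y|)) :=
    tendsto_tsum_of_dominated_convergence hDsum (fun y => (hlim y).abs)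
      (Eventually.of_forall fun k y => by simpa using hsD (φ k) y)
  have hlh : ∑' y, |h y| = l := tendsto_nhds_unique habs (hl.comp hφ.tendsto_atTop)
  have hpushlim : ∀ m y, Tendsto (fun k => s (φ k + m) y) atTop (𝓝 (push (κ ^ m) h y)) := by
    intro m y
    simp only [hpush]
    refine tendsto_tsum_of_dominated_convergence hDsum (fun x => (hlim x).mul_const _)
      (Eventually.of_forall fun k x => ?_)
    rw [norm_mul, Real.norm_eq_abs, Real.norm_of_nonneg measureReal_nonneg]
    exact (mul_le_of_le_one_right (abs_nonneg _) measureReal_le_one).trans (hsD _ _)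
  -- Pushing h by m steps gives the limit of the differences at times φ k + m, whose norms also tend
  -- to l.
  have hpl : ∀ m, ∑' y, |push (κ ^ m) h y| = ∑' y, |h y| := by
    intro m
    have h1 : Tendsto (fun k => ∑' y, |s (φ k + m) y|) atTop (𝓝 (∑' y, |push (κ ^ m) h y|)) :=
      tendsto_tsum_of_dominated_convergence hDsum (fun y => (hpushlim m y).abs)
        (Eventually.of_forall fun k y => by simpa using hsD (φ k + m) y)
    rw [hlh]
    exact tendsto_nhds_unique h1
      (hl.comp ((tendsto_add_atTop_nat m).comp hφ.tendsto_atTop))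
  have hs0 : ∀ n, ∑' y, s n y = 0 := by
    intro n
    have := ((hasSum_measureReal (μ n)).sub (hasSum_measureReal π)).tsum_eq
    simpa using this
  have hsχ : ∀ n, ∑' y, s n y * χ y = 0 := by
    intro n
    have hint : ∀ (ν : Measure S) [IsProbabilityMeasure ν], Integrable χ ν := fun ν _ =>
      Integrable.of_bound (Measurable.of_discrete.aestronglyMeasurable) 1
        (ae_of_all _ fun y => by rcases hχ y with e | e <;> simp [e])
    have hsm : ∀ (ν : Measure S) [IsProbabilityMeasure ν], Summable fun y => ν.real {y} * χ y :=
      fun ν _ => Summable.of_abs ((hasSum_measureReal ν).summable.congr fun y => by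
        rcases hχ y with e | e <;> simp [e, abs_of_nonneg])
    have h1 := hμχ n
    rw [integral_countable (hint (μ n)), integral_countable (hint π)] at h1
    simp only [smul_eq_mul] at h1
    rw [← sub_eq_zero, ← (hsm (μ n)).tsum_sub (hsm π)] at h1
    rw [← h1]
    exact tsum_congr fun y => by rw [hs]; ring
  have h0 : ∑' y, h y = 0 := by
    have : Tendsto (fun k => ∑' y, s (φ k) y) atTop (𝓝 (∑' y, h y)) :=
      tendsto_tsum_of_dominated_convergence hDsum hlim
        (Eventually.of_forall fun k y => hsD (φ k) y)
    simp only [hs0] at this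
    exact tendsto_nhds_unique this tendsto_const_nhds
  have hχ0 : ∑' y, h y * χ y = 0 := by
    have : Tendsto (fun k => ∑' y, s (φ k) y * χ y) atTop (𝓝 (∑' y, h y * χ y)) :=
      tendsto_tsum_of_dominated_convergence hDsum (fun y => (hlim y).mul_const _)
        (Eventually.of_forall fun k y => by
          have := hsD (φ k) y
          rcases hχ y with e | e <;> simpa [e] using this)
    simp only [hsχ] at this
    exact tendsto_nhds_unique this tendsto_const_nhds
  have hzero := eq_zero_of_tsum_abs_push_eq hχ hcoal hhsum h0 hχ0 hpl
  have : l = 0 := by rw [← hlh]; simp [hzero]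
  rwa [this] at hl

/-- Ergodic theorem for a chain with an invariant probability; the classes of its states modulo
the period are `{χ = 1}` and `{χ = -1}`. -/
theorem isErgodicOfPeriod_of_coalesce (hπ : Kernel.Invariant κ π)
    (hc : ∀ x y : S, ∃ n : ℕ, 0 < (κ ^ n) x {y}) {d : ℕ} (hd : d ≠ 0) (hper : HasPeriod κ d)
    {χ : S → ℝ} (hχ : ∀ y, χ y = 1 ∨ χ y = -1)
    (hcoal : ∀ y z, χ y = χ z → ∃ m x, 0 < (κ ^ m) y {x} ∧ 0 < (κ ^ m) z {x})
    (hμχ : ∀ n x, ∫ y, χ y ∂averagedLaw κ d n x = ∫ y, χ y ∂π) :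
    IsErgodicOfPeriod κ d := by
  refine ⟨hc, hper, π, inferInstance, hπ, fun x => ?_⟩
  have := fun n => isProbabilityMeasure_averagedLaw (κ := κ) hd n x
  have hx := invariant_pos hπ hc x
  have hdom : ∀ n y, (averagedLaw κ d n x).real {y} ≤ (π {x})⁻¹.toReal * π.real {y} := by
    intro n y
    rw [Measure.real, Measure.real, ← ENNReal.toReal_mul]
    refine ENNReal.toReal_mono
      (ENNReal.mul_ne_top (ENNReal.inv_ne_top.2 hx.ne') (measure_ne_top _ _)) ?_
    rw [averagedLaw_apply]
    calc (d : ℝ≥0∞)⁻¹ * ∑ r ∈ range d, (κ ^ (n + r)) x {y}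
        ≤ (d : ℝ≥0∞)⁻¹ * ∑ r ∈ range d, (π {x})⁻¹ * π {y} := by
          gcongr
          exact pow_le_inv_mul_invariant hπ hx _ _
      _ = ((d : ℝ≥0∞)⁻¹ * d) * ((π {x})⁻¹ * π {y}) := by
          rw [sum_const, card_range, nsmul_eq_mul, mul_assoc]
      _ = _ := by rw [ENNReal.inv_mul_cancel (by simpa using hd) (by simp), one_mul]
  exact squeeze_zero (fun n => tvDist_nonneg _ _) (fun n => tvDist_le_tsum _ _)
    (tendsto_tsum_abs_sub hπ hχ hcoal (fun n m => averagedLaw_bind_pow d n m x) hdom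
      fun n => hμχ n x)

end Convergence

end MarkovChain

namespace ParallelSystem

variable {N : ℕ}

/-! ### Chains with state-dependent service rates -/

/-- `v x n` is a service rate of server `n` in state `x` which is `μ_n` when queue `n` is nonempty,
and is arbitrary between `0` and `μ_n` otherwise. -/
structure IsServiceRate (Q : ParallelSystem N) (v : (Fin N → ℕ) → Fin N → ℝ) : Prop where
  nonneg : ∀ x n, 0 ≤ v x n
  le : ∀ x n, v x n ≤ Q.mu n
  eq : ∀ x n, 1 ≤ x n → v x n = Q.mu n

lemma isServiceRate_mu (Q : ParallelSystem N) : Q.IsServiceRate fun _ => Q.mu :=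
  ⟨fun _ n => (Q.mu_pos n).le, fun _ _ => le_rfl, fun _ _ _ => rfl⟩

lemma isServiceRate_activeRate (Q : ParallelSystem N) : Q.IsServiceRate Q.activeRate where
  nonneg := Q.activeRate_nonneg
  le x n := by
    unfold activeRate
    split_ifs
    · exact le_rfl
    · exact (Q.mu_pos n).le
  eq x n h := by simp [activeRate, h]

/-- Common form of `eventChain` and `jumpChain`. -/
def rateChain (Q : ParallelSystem N) (ι : ℝ) (w : Fin N → ℝ) (v : (Fin N → ℕ) → Fin N → ℝ) :
    Kernel (Fin N → ℕ) (Fin N → ℕ) where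
  toFun x := ∑ a, ENNReal.ofReal (softmaxWSQ ι w x a) •
    (ENNReal.ofReal (Q.lam / (Q.lam + ∑ k, v x k)) • Measure.dirac (arrive x a) +
      ∑ n, ENNReal.ofReal (v x n / (Q.lam + ∑ k, v x k)) • Measure.dirac (depart x n))
  measurable' := Measurable.of_discrete

lemma jumpChain_eq_rateChain (Q : ParallelSystem N) (ι : ℝ) (w : Fin N → ℝ) :
    Q.jumpChain ι w = Q.rateChain ι w Q.activeRate := rfl

variable {Q : ParallelSystem N} {ι : ℝ} {w : Fin N → ℝ} {v : (Fin N → ℕ) → Fin N → ℝ}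

lemma lintegral_rateChain (x : Fin N → ℕ) (f : (Fin N → ℕ) → ℝ≥0∞) :
    ∫⁻ z, f z ∂Q.rateChain ι w v x = ∑ a, ENNReal.ofReal (softmaxWSQ ι w x a) *
      (ENNReal.ofReal (Q.lam / (Q.lam + ∑ k, v x k)) * f (arrive x a) +
        ∑ n, ENNReal.ofReal (v x n / (Q.lam + ∑ k, v x k)) * f (depart x n)) := by
  change ∫⁻ z, f z ∂(∑ a, ENNReal.ofReal (softmaxWSQ ι w x a) •
    (ENNReal.ofReal (Q.lam / (Q.lam + ∑ k, v x k)) • Measure.dirac (arrive x a) +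
      ∑ n, ENNReal.ofReal (v x n / (Q.lam + ∑ k, v x k)) • Measure.dirac (depart x n))) = _
  simp [lintegral_finsetSum_measure, lintegral_smul_measure, lintegral_add_measure, mul_add]

lemma rateChain_apply (x : Fin N → ℕ) (A : Set (Fin N → ℕ)) :
    Q.rateChain ι w v x A = ∑ a, ENNReal.ofReal (softmaxWSQ ι w x a) *
      (ENNReal.ofReal (Q.lam / (Q.lam + ∑ k, v x k)) * A.indicator 1 (arrive x a) +
        ∑ n, ENNReal.ofReal (v x n / (Q.lam + ∑ k, v x k)) * A.indicator 1 (depart x n)) := by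
  rw [← lintegral_rateChain, lintegral_indicator_one MeasurableSet.of_discrete]

lemma softmaxWSQ_pos (ι : ℝ) (w : Fin N → ℝ) (x : Fin N → ℕ) (a : Fin N) :
    0 < softmaxWSQ ι w x a :=
  div_pos (Real.exp_pos _) (Finset.sum_pos (fun _ _ => Real.exp_pos _) ⟨a, mem_univ a⟩)

lemma IsServiceRate.total_pos (hv : Q.IsServiceRate v) (x : Fin N → ℕ) :
    0 < Q.lam + ∑ k, v x k :=
  add_pos_of_pos_of_nonneg Q.lam_pos (sum_nonneg fun n _ => hv.nonneg x n)

lemma IsServiceRate.isMarkovKernel [NeZero N] (hv : Q.IsServiceRate v) :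
    IsMarkovKernel (Q.rateChain ι w v) :=
  ⟨fun x => ⟨mix_eq_one ι w x _ fun _ => mass_eq_one Q.lam_pos (hv.nonneg x) _ _⟩⟩

lemma rateChain_arrive_pos (hv : Q.IsServiceRate v) (x : Fin N → ℕ) (a : Fin N) :
    0 < Q.rateChain ι w v x {arrive x a} := by
  rw [rateChain_apply]
  refine (ENNReal.mul_pos (ENNReal.ofReal_pos.2 (softmaxWSQ_pos ι w x a)).ne' ?_).trans_le
    (single_le_sum (f := fun a' => ENNReal.ofReal (softmaxWSQ ι w x a') *
      (ENNReal.ofReal (Q.lam / (Q.lam + ∑ k, v x k)) * Set.indicator {arrive x a} 1 (arrive x a') +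
        ∑ n, ENNReal.ofReal (v x n / (Q.lam + ∑ k, v x k)) *
          Set.indicator {arrive x a} 1 (depart x n))) (fun _ _ => zero_le) (mem_univ a))
  have : 0 < Q.lam / (Q.lam + ∑ k, v x k) := div_pos Q.lam_pos (hv.total_pos x)
  simp [this]

lemma rateChain_depart_pos (hv : Q.IsServiceRate v) (x : Fin N → ℕ) (n : Fin N)
    (hn : 0 < v x n) : 0 < Q.rateChain ι w v x {depart x n} := by
  rw [rateChain_apply]
  refine (ENNReal.mul_pos (ENNReal.ofReal_pos.2 (softmaxWSQ_pos ι w x n)).ne' ?_).trans_le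
    (single_le_sum (f := fun a' => ENNReal.ofReal (softmaxWSQ ι w x a') *
      (ENNReal.ofReal (Q.lam / (Q.lam + ∑ k, v x k)) * Set.indicator {depart x n} 1 (arrive x a') +
        ∑ n', ENNReal.ofReal (v x n' / (Q.lam + ∑ k, v x k)) *
          Set.indicator {depart x n} 1 (depart x n'))) (fun _ _ => zero_le) (mem_univ n))
  have h0 : 0 < v x n / (Q.lam + ∑ k, v x k) := div_pos hn (hv.total_pos x)
  refine (lt_of_lt_of_le ?_ (le_add_self.trans' (single_le_sum
    (f := fun n' => ENNReal.ofReal (v x n' / (Q.lam + ∑ k, v x k)) *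
      Set.indicator {depart x n} 1 (depart x n')) (fun _ _ => zero_le) (mem_univ n)))).ne'
  simp [h0]

/-! ### Communication -/

lemma sum_arrive (x : Fin N → ℕ) (a : Fin N) : ∑ n, arrive x a n = ∑ n, x n + 1 := by
  have h := Finset.sum_update_of_mem (mem_univ a) x (x a + 1)
  have h' := Finset.add_sum_erase univ x (mem_univ a)
  rw [Finset.sdiff_singleton_eq_erase] at h
  unfold arrive
  omega

lemma sum_depart {x : Fin N → ℕ} {n : Fin N} (hn : 1 ≤ x n) :
    ∑ k, depart x n k + 1 = ∑ k, x k := by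
  have h := Finset.sum_update_of_mem (mem_univ n) x (x n - 1)
  have h' := Finset.add_sum_erase univ x (mem_univ n)
  rw [Finset.sdiff_singleton_eq_erase] at h
  unfold depart
  omega

lemma arrive_depart {x : Fin N → ℕ} {n : Fin N} (hn : 1 ≤ x n) : arrive (depart x n) n = x := by
  unfold arrive depart
  simp [Nat.sub_add_cancel hn]

lemma depart_arrive (x : Fin N → ℕ) (n : Fin N) : depart (arrive x n) n = x := by
  unfold arrive depart
  simp

lemma exists_one_le {x : Fin N → ℕ} (hx : ∑ n, x n ≠ 0) : ∃ n, 1 ≤ x n := by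
  by_contra! h
  exact hx (sum_eq_zero fun n _ => Nat.lt_one_iff.1 (h n))

/-- The queues are emptied by successive departures. The exact number of steps matters later, for
periods and for simultaneous arrival at the empty state. -/
lemma pow_pos_zero (hv : Q.IsServiceRate v) (x : Fin N → ℕ) :
    0 < (Q.rateChain ι w v ^ ∑ n, x n) x {0} := by
  induction hk : ∑ n, x n generalizing x with
  | zero =>
    have : x = 0 := by
      funext n
      exact (sum_eq_zero_iff.1 hk) n (mem_univ n)
    rw [this]
    change 0 < Measure.dirac _ _
    simp
  | succ k ih =>
    obtain ⟨n, hn⟩ := exists_one_le (x := x) (by omega)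
    have h1 : 0 < (Q.rateChain ι w v ^ 1) x {depart x n} := by
      rw [pow_one]
      exact rateChain_depart_pos hv x n (by rw [hv.eq x n hn]; exact Q.mu_pos n)
    have h2 := ih (depart x n) (by have := sum_depart hn; omega)
    rw [add_comm]
    exact MarkovChain.pow_pos_trans h1 h2

lemma zero_pow_pos (hv : Q.IsServiceRate v) (y : Fin N → ℕ) :
    0 < (Q.rateChain ι w v ^ ∑ n, y n) 0 {y} := by
  induction hk : ∑ n, y n generalizing y with
  | zero =>
    have : y = 0 := by
      funext n
      exact (sum_eq_zero_iff.1 hk) n (mem_univ n)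
    rw [this]
    change 0 < Measure.dirac _ _
    simp
  | succ k ih =>
    obtain ⟨n, hn⟩ := exists_one_le (x := y) (by omega)
    have h1 : 0 < (Q.rateChain ι w v ^ 1) (depart y n) {y} := by
      rw [pow_one]
      simpa only [arrive_depart hn] using rateChain_arrive_pos (ι := ι) (w := w) hv (depart y n) n
    exact MarkovChain.pow_pos_trans (ih (depart y n) (by have := sum_depart hn; omega)) h1

lemma communicates (hv : Q.IsServiceRate v) (x y : Fin N → ℕ) :
    ∃ n, 0 < (Q.rateChain ι w v ^ n) x {y} :=
  ⟨_, MarkovChain.pow_pos_trans (pow_pos_zero hv x) (zero_pow_pos hv y)⟩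

/-- From every state the chain can be back after an arrival and a departure. -/
lemma pow_two_pos [NeZero N] (hv : Q.IsServiceRate v) (x : Fin N → ℕ) :
    0 < (Q.rateChain ι w v ^ 2) x {x} := by
  have h1 : 0 < (Q.rateChain ι w v ^ 1) x {arrive x 0} := by
    rw [pow_one]; exact rateChain_arrive_pos hv x 0
  have h2 : 0 < (Q.rateChain ι w v ^ 1) (arrive x 0) {x} := by
    rw [pow_one]
    have := rateChain_depart_pos (ι := ι) (w := w) hv (arrive x 0) 0 (by
      rw [hv.eq _ _ (by simp [arrive])]; exact Q.mu_pos 0)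
    rwa [depart_arrive] at this
  exact MarkovChain.pow_pos_trans h1 h2

/-! ### Drift -/

/-- The increase of `∑ n, w_n x_n²` when a job joins queue `a`. -/
def joinCost (w : Fin N → ℝ) (x : Fin N → ℕ) (a : Fin N) : ℝ := w a * (2 * (x a : ℝ) + 1)

/-- Weighted quadratic Lyapunov function. -/
def quadratic (w : Fin N → ℝ) (x : Fin N → ℕ) : ℝ := ∑ n, w n * (x n : ℝ) ^ 2

lemma quadratic_update (w : Fin N → ℝ) (x : Fin N → ℕ) (a : Fin N) (k : ℕ) :
    quadratic w (Function.update x a k) = quadratic w x + w a * ((k : ℝ) ^ 2 - (x a : ℝ) ^ 2) := by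
  unfold quadratic
  rw [← Finset.add_sum_erase univ _ (mem_univ a),
    ← Finset.add_sum_erase univ (fun n => w n * (x n : ℝ) ^ 2) (mem_univ a)]
  have : ∑ n ∈ univ.erase a, w n * ((Function.update x a k n : ℕ) : ℝ) ^ 2 =
      ∑ n ∈ univ.erase a, w n * (x n : ℝ) ^ 2 :=
    sum_congr rfl fun n hn => by rw [Function.update_of_ne (ne_of_mem_erase hn)]
  rw [this]
  simp
  ring

lemma quadratic_arrive (w : Fin N → ℝ) (x : Fin N → ℕ) (a : Fin N) :
    quadratic w (arrive x a) = quadratic w x + joinCost w x a := by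
  rw [arrive, quadratic_update, joinCost]
  push_cast
  ring

lemma quadratic_nonneg (hw : ∀ n, 0 < w n) (x : Fin N → ℕ) : 0 ≤ quadratic w x :=
  sum_nonneg fun n _ => mul_nonneg (hw n).le (sq_nonneg _)

lemma joinCost_pos (hw : ∀ n, 0 < w n) (x : Fin N → ℕ) (a : Fin N) : 0 < joinCost w x a :=
  mul_pos (hw a) (by positivity)

/-- A departure from a nonempty queue lowers the quadratic by w_n(2x_n - 1), which is `joinCost`
minus 2w_n. At an empty queue `joinCost` is only w_n, so the constant 2μ_n w_n absorbs it whatever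
the value of `v`. -/
lemma IsServiceRate.mul_quadratic_depart_le (hv : Q.IsServiceRate v) (hw : ∀ n, 0 < w n)
    (x : Fin N → ℕ) (n : Fin N) : v x n * quadratic w (depart x n) ≤
      v x n * quadratic w x - Q.mu n * joinCost w x n + 2 * (Q.mu n * w n) := by
  have hμw : 0 < Q.mu n * w n := mul_pos (Q.mu_pos n) (hw n)
  rw [depart, quadratic_update, joinCost]
  rcases Nat.eq_zero_or_pos (x n) with h | h
  · simp [h]; linarith
  · rw [hv.eq x n h, Nat.cast_sub h]
    push_cast
    linarith

/-- The softmax policy loses at most `N ι` with respect to the best queue. -/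
lemma sum_softmaxWSQ_mul_joinCost_le [NeZero N] (hι : 0 < ι) (w : Fin N → ℝ) (x : Fin N → ℕ)
    (c : Fin N) : ∑ a, softmaxWSQ ι w x a * joinCost w x a ≤ joinCost w x c + N * ι := by
  have hterm : ∀ a, softmaxWSQ ι w x a * (joinCost w x a - joinCost w x c) ≤ ι := by
    intro a
    set t := (joinCost w x a - joinCost w x c) / ι with ht
    -- Only the term of c is kept in the denominator; the bound then follows from t exp(-t) ≤ 1.
    have hπ : softmaxWSQ ι w x a ≤ Real.exp (-t) := by
      have hden : Real.exp (-joinCost w x c / ι) ≤ ∑ b, Real.exp (-joinCost w x b / ι) :=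
        single_le_sum (f := fun b => Real.exp (-joinCost w x b / ι))
          (fun b _ => (Real.exp_pos _).le) (mem_univ c)
      calc softmaxWSQ ι w x a ≤ Real.exp (-joinCost w x a / ι) / Real.exp (-joinCost w x c / ι) :=
            div_le_div_of_nonneg_left (Real.exp_pos _).le (Real.exp_pos _) hden
        _ = Real.exp (-t) := by rw [← Real.exp_sub, ht]; congr 1; ring
    have h1 : softmaxWSQ ι w x a * t ≤ 1 := by
      rcases le_or_gt t 0 with h | h
      · exact (mul_nonpos_of_nonneg_of_nonpos (softmaxWSQ_nonneg ι w x a) h).trans zero_le_one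
      · calc softmaxWSQ ι w x a * t ≤ Real.exp (-t) * Real.exp t := by
              gcongr
              linarith [Real.add_one_le_exp t]
          _ = 1 := by rw [← Real.exp_add]; simp
    have h2 : joinCost w x a - joinCost w x c = t * ι := by rw [ht]; field_simp
    rw [h2, ← mul_assoc]
    exact mul_le_of_le_one_left hι.le h1
  have hsum := sum_le_sum fun a (_ : a ∈ univ) => hterm a
  simp only [mul_sub, sum_sub_distrib, ← sum_mul, sum_softmaxWSQ, sum_const, card_univ,
    Fintype.card_fin, nsmul_eq_mul, one_mul] at hsum
  linarith

/-- Bound on the generator of the queue lengths applied to `quadratic w`. -/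
def driftBound (Q : ParallelSystem N) (ι : ℝ) (w : Fin N → ℝ) (x : Fin N → ℕ) : ℝ :=
  Q.lam * (N * ι) + 2 * ∑ n, Q.mu n * w n -
    (1 - Q.lam / ∑ n, Q.mu n) * ∑ n, Q.mu n * joinCost w x n

lemma generator_quadratic_le [NeZero N] (hv : Q.IsServiceRate v) (hι : 0 < ι)
    (hw : ∀ n, 0 < w n) (x : Fin N → ℕ) :
    Q.lam * ∑ a, softmaxWSQ ι w x a * quadratic w (arrive x a) +
      ∑ n, v x n * quadratic w (depart x n) ≤
      (Q.lam + ∑ n, v x n) * quadratic w x + driftBound Q ι w x := by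
  have hM : 0 < ∑ n, Q.mu n := sum_pos (fun n _ => Q.mu_pos n) univ_nonempty
  have h1 : ∑ a, softmaxWSQ ι w x a * quadratic w (arrive x a) =
      quadratic w x + ∑ a, softmaxWSQ ι w x a * joinCost w x a := by
    simp only [quadratic_arrive, mul_add, sum_add_distrib, ← sum_mul, sum_softmaxWSQ, one_mul]
  have h2 : ∑ n, v x n * quadratic w (depart x n) ≤ (∑ n, v x n) * quadratic w x -
      ∑ n, Q.mu n * joinCost w x n + 2 * ∑ n, Q.mu n * w n := by
    have := sum_le_sum fun n (_ : n ∈ univ) => hv.mul_quadratic_depart_le hw x n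
    simpa only [sum_add_distrib, sum_sub_distrib, ← sum_mul, ← mul_sum] using this
  -- The comparison with a single queue c is averaged over c with weights μ_c / ∑ μ.
  have h3 : ∑ a, softmaxWSQ ι w x a * joinCost w x a ≤
      (∑ n, Q.mu n * joinCost w x n) / (∑ n, Q.mu n) + N * ι := by
    have := sum_le_sum fun c (_ : c ∈ univ) => mul_le_mul_of_nonneg_left
      (sum_softmaxWSQ_mul_joinCost_le hι w x c) (Q.mu_pos c).le
    simp only [mul_add, sum_add_distrib, ← sum_mul] at this
    rw [← sub_le_iff_le_add, le_div_iff₀ hM]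
    linarith
  have h4 := mul_le_mul_of_nonneg_left h3 Q.lam_pos.le
  have h5 : Q.lam * ((∑ n, Q.mu n * joinCost w x n) / (∑ n, Q.mu n) + N * ι) =
      Q.lam * (N * ι) + Q.lam / (∑ n, Q.mu n) * ∑ n, Q.mu n * joinCost w x n := by
    field_simp
    ring
  rw [h1]
  unfold driftBound
  linarith

lemma driftBound_le [NeZero N] (hQ : Q.Stabilizable) (hw : ∀ n, 0 < w n) (x : Fin N → ℕ) :
    driftBound Q ι w x ≤ Q.lam * (N * ι) + 2 * ∑ n, Q.mu n * w n := by
  have hM : 0 < ∑ n, Q.mu n := Q.lam_pos.trans hQ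
  have h1 : 0 ≤ 1 - Q.lam / ∑ n, Q.mu n := sub_nonneg.2 ((div_le_one hM).2 (le_of_lt hQ))
  have h2 : 0 ≤ ∑ n, Q.mu n * joinCost w x n :=
    sum_nonneg fun n _ => mul_nonneg (Q.mu_pos n).le (joinCost_pos hw x n).le
  exact sub_le_self _ (mul_nonneg h1 h2)

lemma finite_lt_driftBound (hQ : Q.Stabilizable) (hw : ∀ n, 0 < w n) (ι t : ℝ) :
    {x : Fin N → ℕ | t < driftBound Q ι w x}.Finite := by
  have hM : 0 < ∑ n, Q.mu n := Q.lam_pos.trans hQ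
  set c := 1 - Q.lam / ∑ n, Q.mu n with hc
  have hcpos : 0 < c := sub_pos.2 ((div_lt_one hM).2 hQ)
  set T := Q.lam * (N * ι) + 2 * ∑ n, Q.mu n * w n - t with hT
  refine (Set.finite_Icc 0 fun n => ⌈T / (c * (Q.mu n * w n))⌉₊).subset fun x hx => ?_
  refine ⟨fun n => Nat.zero_le _, fun n => ?_⟩
  have hx' : t < driftBound Q ι w x := hx
  have h1 : c * ∑ n, Q.mu n * joinCost w x n < T := by
    unfold driftBound at hx'
    linarith
  have h2 : Q.mu n * joinCost w x n ≤ ∑ n, Q.mu n * joinCost w x n :=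
    single_le_sum (f := fun n => Q.mu n * joinCost w x n)
      (fun n _ => mul_nonneg (Q.mu_pos n).le (joinCost_pos hw x n).le) (mem_univ n)
  have hμw : 0 < Q.mu n * w n := mul_pos (Q.mu_pos n) (hw n)
  have h3 : Q.mu n * w n * x n ≤ Q.mu n * joinCost w x n := by
    rw [joinCost, ← mul_assoc]
    gcongr
    have : (0 : ℝ) ≤ x n := by positivity
    linarith
  have h4 : (x n : ℝ) ≤ T / (c * (Q.mu n * w n)) := by
    rw [le_div_iff₀ (by positivity)]
    calc (x n : ℝ) * (c * (Q.mu n * w n)) = c * (Q.mu n * w n * x n) := by ring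
      _ ≤ c * ∑ n, Q.mu n * joinCost w x n := by gcongr; exact h3.trans h2
      _ ≤ T := h1.le
  exact_mod_cast h4.trans (Nat.le_ceil _)

/-- The generator bound dominates a nonnegative quantity. Nonnegativity is what allows the summand 1
of the drift condition to be merged inside `ENNReal.ofReal`. -/
lemma quadratic_add_drift_nonneg [NeZero N] (hv : Q.IsServiceRate v) (hι : 0 < ι)
    (hw : ∀ n, 0 < w n) (x : Fin N → ℕ) :
    0 ≤ quadratic w x + driftBound Q ι w x / (Q.lam + ∑ n, v x n) := by
  have hL := hv.total_pos x
  have h1 : 0 ≤ Q.lam * ∑ a, softmaxWSQ ι w x a * quadratic w (arrive x a) +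
      ∑ n, v x n * quadratic w (depart x n) :=
    add_nonneg (mul_nonneg Q.lam_pos.le (sum_nonneg fun a _ =>
      mul_nonneg (softmaxWSQ_nonneg ι w x a) (quadratic_nonneg hw _)))
      (sum_nonneg fun n _ => mul_nonneg (hv.nonneg x n) (quadratic_nonneg hw _))
  have h2 := div_nonneg (h1.trans (generator_quadratic_le hv hι hw x)) hL.le
  rwa [add_div, mul_div_cancel_left₀ _ hL.ne'] at h2

lemma lintegral_quadratic_rateChain_le [NeZero N] (hv : Q.IsServiceRate v) (hι : 0 < ι)
    (hw : ∀ n, 0 < w n) (x : Fin N → ℕ) :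
    ∫⁻ z, ENNReal.ofReal (quadratic w z) ∂Q.rateChain ι w v x ≤
      ENNReal.ofReal (quadratic w x + driftBound Q ι w x / (Q.lam + ∑ n, v x n)) := by
  set L := Q.lam + ∑ n, v x n with hL
  have hLpos : 0 < L := hv.total_pos x
  have hq := quadratic_nonneg (N := N) hw
  have hlam : 0 ≤ Q.lam / L := div_nonneg Q.lam_pos.le hLpos.le
  have hvL : ∀ n, 0 ≤ v x n / L := fun n => div_nonneg (hv.nonneg x n) hLpos.le
  have hterm : ∀ n, 0 ≤ v x n / L * quadratic w (depart x n) := fun n =>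
    mul_nonneg (hvL n) (hq _)
  have hinner : ∀ a, 0 ≤ Q.lam / L * quadratic w (arrive x a) +
      ∑ n, v x n / L * quadratic w (depart x n) := fun a =>
    add_nonneg (mul_nonneg hlam (hq _)) (sum_nonneg fun n _ => hterm n)
  rw [lintegral_rateChain]
  have hreal : ∑ a, ENNReal.ofReal (softmaxWSQ ι w x a) *
      (ENNReal.ofReal (Q.lam / L) * ENNReal.ofReal (quadratic w (arrive x a)) +
        ∑ n, ENNReal.ofReal (v x n / L) * ENNReal.ofReal (quadratic w (depart x n))) =
      ENNReal.ofReal (∑ a, softmaxWSQ ι w x a * (Q.lam / L * quadratic w (arrive x a) +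
        ∑ n, v x n / L * quadratic w (depart x n))) := by
    rw [ENNReal.ofReal_sum_of_nonneg
      fun a _ => mul_nonneg (softmaxWSQ_nonneg ι w x a) (hinner a)]
    refine sum_congr rfl fun a _ => ?_
    rw [ENNReal.ofReal_mul (softmaxWSQ_nonneg ι w x a),
      ENNReal.ofReal_add (mul_nonneg hlam (hq _)) (sum_nonneg fun n _ => hterm n),
      ENNReal.ofReal_mul hlam, ENNReal.ofReal_sum_of_nonneg fun n _ => hterm n]
    simp only [ENNReal.ofReal_mul (hvL _)]
  rw [hreal]
  refine ENNReal.ofReal_le_ofReal ?_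
  have hsplit : ∑ a, softmaxWSQ ι w x a * (Q.lam / L * quadratic w (arrive x a) +
      ∑ n, v x n / L * quadratic w (depart x n)) =
      (Q.lam * ∑ a, softmaxWSQ ι w x a * quadratic w (arrive x a) +
        ∑ n, v x n * quadratic w (depart x n)) / L := by
    simp only [mul_add, sum_add_distrib, ← sum_mul, sum_softmaxWSQ, one_mul, add_div]
    congr 1
    · rw [mul_sum, sum_div]
      exact sum_congr rfl fun a _ => by ring
    · rw [sum_div]
      exact sum_congr rfl fun n _ => by ring
  rw [hsplit, div_le_iff₀ hLpos, add_mul, div_mul_cancel₀ _ hLpos.ne', mul_comm (quadratic w x)]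
  exact generator_quadratic_le hv hι hw x

lemma exists_invariant [NeZero N] (hQ : Q.Stabilizable) (hv : Q.IsServiceRate v) (hι : 0 < ι)
    (hw : ∀ n, 0 < w n) :
    ∃ π : Measure (Fin N → ℕ), IsProbabilityMeasure π ∧ Kernel.Invariant (Q.rateChain ι w v) π := by
  have := hv.isMarkovKernel (ι := ι) (w := w)
  set K := Q.lam * (N * ι) + 2 * ∑ n, Q.mu n * w n with hK
  have hK0 : 0 ≤ K := add_nonneg (mul_nonneg Q.lam_pos.le (by positivity))
    (mul_nonneg zero_le_two (sum_nonneg fun n _ => (mul_pos (Q.mu_pos n) (hw n)).le))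
  -- Off this set the drift bound is at most minus the largest possible total rate, so dividing by
  -- the actual total rate leaves at most -1. On the set, the bound is at most `K` and the total
  -- rate at least λ.
  have hfin := finite_lt_driftBound hQ hw ι (-(Q.lam + ∑ n, Q.mu n))
  refine MarkovChain.exists_invariant_of_drift (W := fun x => ENNReal.ofReal (quadratic w x))
    (fun _ => ENNReal.ofReal_ne_top) (b := ENNReal.ofReal (K / Q.lam + 1)) ENNReal.ofReal_ne_top
    (B := hfin.toFinset) fun x => ?_
  have hL : 0 < Q.lam + ∑ n, v x n := hv.total_pos x
  refine (add_le_add_left (lintegral_quadratic_rateChain_le hv hι hw x) 1).trans ?_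
  rw [← ENNReal.ofReal_one, ← ENNReal.ofReal_add (quadratic_add_drift_nonneg hv hι hw x) zero_le_one]
  by_cases hx : -(Q.lam + ∑ n, Q.mu n) < driftBound Q ι w x
  · have hmem : x ∈ (hfin.toFinset : Set (Fin N → ℕ)) := by simpa using hx
    have hb : 0 ≤ K / Q.lam + 1 := add_nonneg (div_nonneg hK0 Q.lam_pos.le) zero_le_one
    rw [Set.indicator_of_mem hmem, Pi.one_apply, mul_one,
      ← ENNReal.ofReal_add (quadratic_nonneg hw x) hb]
    refine ENNReal.ofReal_le_ofReal ?_
    have h1 : driftBound Q ι w x / (Q.lam + ∑ n, v x n) ≤ K / Q.lam :=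
      div_le_div₀ hK0 (driftBound_le hQ hw x) Q.lam_pos
        (le_add_of_nonneg_right (sum_nonneg fun n _ => hv.nonneg x n))
    linarith
  · have hmem : x ∉ (hfin.toFinset : Set (Fin N → ℕ)) := by simpa using hx
    rw [Set.indicator_of_notMem hmem, mul_zero, add_zero]
    refine ENNReal.ofReal_le_ofReal ?_
    have h1 : ∑ n, v x n ≤ ∑ n, Q.mu n := sum_le_sum fun n _ => hv.le x n
    have h2 : driftBound Q ι w x / (Q.lam + ∑ n, v x n) ≤ -1 := by
      rw [div_le_iff₀ hL]
      linarith [not_lt.1 hx]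
    linarith

/-! ### The chain at the epochs of the merged Poisson clock -/

lemma eventChain_pow_zero_pos [NeZero N] (Q : ParallelSystem N) (ι : ℝ) (w : Fin N → ℝ) (n : ℕ) :
    0 < (Q.eventChain ι w ^ n) 0 {0} := by
  induction n with
  | zero =>
    change 0 < Measure.dirac _ _
    simp
  | succ n ih =>
    refine MarkovChain.pow_pos_trans ih ?_
    rw [pow_one]
    have h := rateChain_depart_pos (ι := ι) (w := w) Q.isServiceRate_mu 0 0 (Q.mu_pos 0)
    have h0 : depart (0 : Fin N → ℕ) 0 = 0 := by simp [depart]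
    rwa [h0] at h

/-- A potential service at the empty state is a self-loop. Excursions to the empty state can thus be
prolonged by one step, and two return times differ by 1. -/
lemma hasPeriod_eventChain [NeZero N] (Q : ParallelSystem N) (ι : ℝ) (w : Fin N → ℝ) :
    MarkovChain.HasPeriod (Q.eventChain ι w) 1 := by
  refine fun x m => ⟨fun h => ?_, fun h n _ _ => (Nat.dvd_one.1 h) ▸ one_dvd n⟩
  have hret : ∀ k, 0 < (Q.eventChain ι w ^ (∑ n, x n + k + ∑ n, x n)) x {x} := fun k =>
    MarkovChain.pow_pos_trans (MarkovChain.pow_pos_trans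
      (pow_pos_zero Q.isServiceRate_mu x) (eventChain_pow_zero_pos Q ι w k))
      (zero_pow_pos Q.isServiceRate_mu x)
  have h1 := h _ (by omega) (hret 1)
  have h2 := h _ (by omega) (hret 2)
  have := Nat.dvd_sub h2 h1
  rwa [show ∑ n, x n + 2 + ∑ n, x n - (∑ n, x n + 1 + ∑ n, x n) = 1 by omega] at this

lemma isErgodic_eventChain [NeZero N] (Q : ParallelSystem N) (ι : ℝ) (w : Fin N → ℝ)
    {π : Measure (Fin N → ℕ)} [IsProbabilityMeasure π]
    (hπ : Kernel.Invariant (Q.eventChain ι w) π) : MarkovChain.IsErgodic (Q.eventChain ι w) := by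
  -- The constant χ = 1 expresses that there is one cyclic class. Any two states meet at 0, the one
  -- needing fewer steps waiting there on the self-loop.
  refine MarkovChain.isErgodicOfPeriod_of_coalesce hπ (communicates Q.isServiceRate_mu) one_ne_zero
    (hasPeriod_eventChain Q ι w) (χ := fun _ => 1) (fun _ => Or.inl rfl) (fun y z _ => ?_)
    fun n x => ?_
  · refine ⟨∑ n, y n + ∑ n, z n, 0, ?_, ?_⟩
    · exact MarkovChain.pow_pos_trans (pow_pos_zero Q.isServiceRate_mu y)
        (eventChain_pow_zero_pos Q ι w _)
    · rw [add_comm]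
      exact MarkovChain.pow_pos_trans (pow_pos_zero Q.isServiceRate_mu z)
        (eventChain_pow_zero_pos Q ι w _)
  · have := MarkovChain.isProbabilityMeasure_averagedLaw (κ := Q.eventChain ι w) one_ne_zero n x
    simp

/-! ### The chain at its jump epochs -/

/-- Parity of the total number of jobs. -/
def paritySign (x : Fin N → ℕ) : ℝ := (-1) ^ ∑ n, x n

lemma paritySign_eq (x : Fin N → ℕ) : paritySign x = 1 ∨ paritySign x = -1 :=
  neg_one_pow_eq_or ℝ _

/-- Each jump changes the number of jobs by exactly one; the departures that would change nothing
carry rate zero. -/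
lemma jumpChain_apply_paritySign (Q : ParallelSystem N) (ι : ℝ) (w : Fin N → ℝ) (x : Fin N → ℕ) :
    Q.jumpChain ι w x {z | paritySign z ≠ -paritySign x} = 0 := by
  rw [jumpChain_eq_rateChain, rateChain_apply]
  refine sum_eq_zero fun a _ => ?_
  have harr : arrive x a ∉ {z : Fin N → ℕ | paritySign z ≠ -paritySign x} := by
    simp [paritySign, sum_arrive, pow_succ]
  rw [Set.indicator_of_notMem harr, mul_zero, zero_add, sum_eq_zero, mul_zero]
  intro n _
  by_cases hn : 1 ≤ x n
  · have hdep : depart x n ∉ {z : Fin N → ℕ | paritySign z ≠ -paritySign x} := by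
      simp [paritySign, ← sum_depart hn, pow_succ]
    rw [Set.indicator_of_notMem hdep, mul_zero]
  · simp [activeRate, hn]

lemma ae_pow_jumpChain_paritySign (Q : ParallelSystem N) (ι : ℝ) (w : Fin N → ℝ)
    (x : Fin N → ℕ) (n : ℕ) :
    ∀ᵐ z ∂(Q.jumpChain ι w ^ n) x, paritySign z = (-1) ^ n * paritySign x := by
  induction n with
  | zero =>
    change ∀ᵐ z ∂Measure.dirac x, _
    rw [ae_dirac_eq]
    simp
  | succ n ih =>
    rw [ae_iff, Kernel.pow_succ_apply_eq_lintegral _ _ _ MeasurableSet.of_discrete,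
      lintegral_eq_zero_iff Measurable.of_discrete]
    filter_upwards [ih] with y hy
    refine measure_mono_null (fun z hz => ?_) (jumpChain_apply_paritySign Q ι w y)
    intro h
    refine hz ?_
    rw [h, hy, pow_succ]
    ring

lemma integral_pow_jumpChain_paritySign [NeZero N] (Q : ParallelSystem N) (ι : ℝ) (w : Fin N → ℝ)
    (x : Fin N → ℕ) (n : ℕ) :
    ∫ z, paritySign z ∂(Q.jumpChain ι w ^ n) x = (-1) ^ n * paritySign x := by
  rw [integral_congr_ae (ae_pow_jumpChain_paritySign Q ι w x n)]
  simp

lemma integrable_paritySign (μ : Measure (Fin N → ℕ)) [IsFiniteMeasure μ] :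
    Integrable paritySign μ :=
  Integrable.of_bound Measurable.of_discrete.aestronglyMeasurable 1
    (ae_of_all _ fun x => by rcases paritySign_eq x with h | h <;> simp [h])

/-- One step reverses the parity, so under an invariant law the mean parity sign equals its own
negative. -/
lemma integral_invariant_paritySign [NeZero N] (Q : ParallelSystem N) (ι : ℝ) (w : Fin N → ℝ)
    {π : Measure (Fin N → ℕ)} [IsProbabilityMeasure π]
    (hπ : Kernel.Invariant (Q.jumpChain ι w) π) : ∫ z, paritySign z ∂π = 0 := by
  have h := Kernel.integral_comp (η := Q.jumpChain ι w) (κ := Kernel.const Unit π) (a := ())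
    (integrable_paritySign _)
  rw [Kernel.comp_apply, Kernel.const_apply, hπ.def] at h
  have h1 : ∀ x, ∫ z, paritySign z ∂Q.jumpChain ι w x = -paritySign x := fun x => by
    have := integral_pow_jumpChain_paritySign Q ι w x 1
    simpa using this
  simp only [h1, integral_neg] at h
  linarith

lemma jumpChain_pow_zero_pos [NeZero N] (Q : ParallelSystem N) (ι : ℝ) (w : Fin N → ℝ) (k : ℕ) :
    0 < (Q.jumpChain ι w ^ (2 * k)) 0 {0} := by
  induction k with
  | zero =>
    change 0 < Measure.dirac _ _
    simp
  | succ k ih => exact MarkovChain.pow_pos_trans ih (pow_two_pos Q.isServiceRate_activeRate 0)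

lemma hasPeriod_jumpChain [NeZero N] (Q : ParallelSystem N) (ι : ℝ) (w : Fin N → ℝ) :
    MarkovChain.HasPeriod (Q.jumpChain ι w) 2 := by
  refine fun x m => ⟨fun h => h 2 (by norm_num) (pow_two_pos Q.isServiceRate_activeRate x),
    fun h n _ hn => h.trans ?_⟩
  by_contra hodd
  have hodd' : Odd n := Nat.not_even_iff_odd.1 (mt Even.two_dvd hodd)
  refine hn.ne' (measure_mono_null ?_ (ae_iff.1 (ae_pow_jumpChain_paritySign Q ι w x n)))
  intro z hz
  rw [Set.mem_singleton_iff.1 hz]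
  change ¬ _
  rw [hodd'.neg_one_pow]
  rcases paritySign_eq x with h | h <;> rw [h] <;> norm_num

lemma even_add_of_paritySign_eq {y z : Fin N → ℕ} (h : paritySign y = paritySign z) :
    Even (∑ n, y n + ∑ n, z n) := by
  have h1 : ((-1 : ℝ)) ^ (∑ n, y n + ∑ n, z n) = 1 := by
    rw [pow_add]
    change paritySign y * paritySign z = 1
    rcases paritySign_eq z with e | e <;> rw [h, e] <;> norm_num
  exact (neg_one_pow_eq_one_iff_even (by norm_num)).1 h1

lemma isErgodicOfPeriod_jumpChain [NeZero N] (Q : ParallelSystem N) (ι : ℝ) (w : Fin N → ℝ)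
    {π : Measure (Fin N → ℕ)} [IsProbabilityMeasure π]
    (hπ : Kernel.Invariant (Q.jumpChain ι w) π) :
    MarkovChain.IsErgodicOfPeriod (Q.jumpChain ι w) 2 := by
  refine MarkovChain.isErgodicOfPeriod_of_coalesce hπ (communicates Q.isServiceRate_activeRate)
    two_ne_zero (hasPeriod_jumpChain Q ι w) paritySign_eq (fun y z hyz => ?_) fun n x => ?_
  · obtain ⟨k, hk⟩ := even_add_of_paritySign_eq hyz
    refine ⟨∑ n, y n + 2 * ∑ n, z n, 0, ?_, ?_⟩
    · exact MarkovChain.pow_pos_trans (pow_pos_zero Q.isServiceRate_activeRate y)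
        (jumpChain_pow_zero_pos Q ι w _)
    · rw [show ∑ n, y n + 2 * ∑ n, z n = ∑ n, z n + 2 * k by omega]
      exact MarkovChain.pow_pos_trans (pow_pos_zero Q.isServiceRate_activeRate z)
        (jumpChain_pow_zero_pos Q ι w _)
  · rw [integral_invariant_paritySign Q ι w hπ, MarkovChain.averagedLaw, integral_smul_measure,
      integral_finsetSum_measure fun r _ => integrable_paritySign _]
    simp only [integral_pow_jumpChain_paritySign, sum_range_succ, range_zero, sum_empty]
    simp [pow_succ]

end ParallelSystem
end

theorem mainTheorem2 (N : ℕ) [NeZero N] (Q : ParallelSystem N) (hQ : Q.Stabilizable)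
    (ι : ℝ) (hι : 0 < ι) (w : Fin N → ℝ) (hw : ∀ n, 0 < w n) :
    (MarkovChain.IsErgodic (Q.eventChain ι w) ∧
      MarkovChain.IsPositiveHarris (Q.eventChain ι w)) ∧
    (MarkovChain.IsErgodicOfPeriod (Q.jumpChain ι w) 2 ∧
      MarkovChain.IsPositiveHarris (Q.jumpChain ι w)) := by
  obtain ⟨π, _, hπ⟩ := ParallelSystem.exists_invariant hQ Q.isServiceRate_mu hι hw
  obtain ⟨π', _, hπ'⟩ := ParallelSystem.exists_invariant hQ Q.isServiceRate_activeRate hι hw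
  exact ⟨⟨Q.isErgodic_eventChain ι w hπ, MarkovChain.isPositiveHarris_of_communicates
      (κ := Q.eventChain ι w) hπ (ParallelSystem.communicates Q.isServiceRate_mu)⟩,
    ⟨Q.isErgodicOfPeriod_jumpChain ι w hπ', MarkovChain.isPositiveHarris_of_communicates
      (κ := Q.jumpChain ι w) hπ' (ParallelSystem.communicates Q.isServiceRate_activeRate)⟩⟩
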